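/- Let $\mathbb Z$ carry the discrete Laplacian $\Delta_d f(n)=f(n+1)-2f(n)+f(n-1)$. For $t>0$ and $n\in\mathbb Z$ let $$G(t,n)=e^{-2t}I_n(2t),\qquad I_n(t)=\sum_{m=0}^\infty\frac{1}{m!\,\Gamma(m+|n|+1)}\Big(\frac t2\Big)^{2m+|n|},$$ be the heat kernel of $\Delta_d$, and let $e^{t\Delta_d}f(n)=\sum_{j\in\mathbb Z}G(t,n-j)f(j)$ be the heat semigroup. Let $\mu=\sum_{n\in\mathbb Z}\frac1{1+|n|}\delta_n$. For $1\le p,q\le\infty$ and $u:(0,\infty)\times\mathbb Z\to\mathbb R$ put $$\|u\|_{p,q}=\Big(\int_0^\infty\|u(t,\cdot)\|_{\ell^p(\mathbb Z)}^q\,\frac{dt}t\Big)^{1/q}\ (q<\infty),\qquad \|u\|_{p,\infty}=\operatorname*{ess\,sup}_{t>0}\|u(t,\cdot)\|_{\ell^p(\mathbb Z)}.$$ For $\alpha>0$ let $\Lambda_H^{\alpha,p,q}$ be the set of all $f:\mathbb Z\to\mathbb R$ such that $$\frac{f}{1+|\cdot|^\alpha}\in\ell^q(\mathbb Z,\mu)\quad\text{and}\quad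 \big\|t^{k-\alpha/2}\,\partial_t^k e^{t\Delta_d}f\big\|_{p,q}<\infty,\qquad k=\lfloor\alpha/2\rfloor+1.$$ **Theorem.** Let $\alpha,\beta>0$, $1\le p,q\le\infty$ and $f\in\Lambda_H^{\alpha,p,q}$. Then the Bessel potential $$(I-\Delta_d)^{-\beta/2}f(n)=\frac1{\Gamma(\beta/2)}\int_0^\infty e^{-\tau}\,e^{\tau\Delta_d}f(n)\,\tau^{\beta/2}\,\frac{d\tau}\tau,\qquad n\in\mathbb Z,$$ is well defined (for every $n$, the series $e^{\tau\Delta_d}f(n)$ for each $\tau>0$, and the integral, converge absolutely), and $$(I-\Delta_d)^{-\beta/2}f\in\Lambda_H^{\alpha+\beta,p,q}.$$ -/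

import Mathlib

open MeasureTheory Set
open scoped ENNReal Nat

noncomputable section

namespace DiscreteBesov

/-- The modified Bessel function of the first kind of integer order `n`, through its power series
`I_n(t) = ∑_{m ≥ 0} (t/2)^(2m+|n|) / (m! Γ(m+|n|+1))`; in particular `I_{-n} = I_n`. -/
def besselI (n : ℤ) (t : ℝ) : ℝ :=
  ∑' m : ℕ, (t / 2) ^ (2 * m + n.natAbs) / ((m ! : ℝ) * ((m + n.natAbs)! : ℝ))

/-- The heat kernel `G(t,n) = e^{-2t} I_n(2t)` of the discrete Laplacian
`Δ_d f(n) = f(n+1) - 2 f(n) + f(n-1)` on `ℤ`. -/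
def heatKernel (t : ℝ) (n : ℤ) : ℝ :=
  Real.exp (-2 * t) * besselI n (2 * t)

/-- The heat semigroup `e^{tΔ_d} f(n) = ∑_{j ∈ ℤ} G(t,n-j) f(j)`. -/
def heatSemigroup (t : ℝ) (f : ℤ → ℝ) (n : ℤ) : ℝ :=
  ∑' j : ℤ, heatKernel t (n - j) * f j

/-- The measure `μ = ∑_{n ∈ ℤ} (1+|n|)⁻¹ δ_n` on `ℤ`. -/
def weightMeasure : Measure ℤ :=
  Measure.sum fun n : ℤ => ENNReal.ofReal (1 / (1 + |(n : ℝ)|)) • Measure.dirac n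

/-- The measure `dt/t` on `(0,∞)`. -/
def multMeasure : Measure ℝ :=
  (volume.restrict (Ioi 0)).withDensity fun t => ENNReal.ofReal (1 / t)

/-- The mixed norm of `L^q((0,∞), dt/t; ℓ^p(ℤ))`, with values in `[0,∞]`; `ℓ^p(ℤ)` is taken with
respect to the counting measure, and for `p = ∞` or `q = ∞` the norm is the essential supremum. -/
def mixedNorm (p q : ℝ≥0∞) (u : ℝ → ℤ → ℝ) : ℝ≥0∞ :=
  eLpNorm (fun t : ℝ => eLpNorm (u t) p Measure.count) q multMeasure

/-- The discrete heat Besov space `Λ_H^{α,p,q}`: the functions `f : ℤ → ℝ` such that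
`f / (1+|·|^α) ∈ ℓ^q(ℤ,μ)` and `‖t^{k-α/2} ∂_t^k e^{tΔ_d} f‖_{p,q} < ∞` for `k = [α/2] + 1`.
By the first condition the heat semigroup converges and is smooth in `t > 0`. -/
def heatBesov (α : ℝ) (p q : ℝ≥0∞) : Set (ℤ → ℝ) :=
  {f | MemLp (fun n : ℤ => f n / (1 + |(n : ℝ)| ^ α)) q weightMeasure ∧
    mixedNorm p q (fun t n =>
      t ^ (((⌊α / 2⌋₊ + 1 : ℕ) : ℝ) - α / 2) *
        iteratedDeriv (⌊α / 2⌋₊ + 1) (fun s => heatSemigroup s f n) t) < ∞}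

/-- The integrand `e^{-τ(I-Δ_d)} f(n) τ^{β/2} / τ` of the Bessel potential, where
`e^{-τ(I-Δ_d)} f = e^{-τ} e^{τΔ_d} f`. -/
def besselIntegrand (β : ℝ) (f : ℤ → ℝ) (n : ℤ) (τ : ℝ) : ℝ :=
  Real.exp (-τ) * heatSemigroup τ f n * (τ ^ (β / 2) / τ)

/-- The Bessel potential
`(I-Δ_d)^{-β/2} f(n) = Γ(β/2)⁻¹ ∫_0^∞ e^{-τ(I-Δ_d)} f(n) τ^{β/2} dτ/τ`. -/
def besselPotential (β : ℝ) (f : ℤ → ℝ) (n : ℤ) : ℝ :=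
  1 / Real.Gamma (β / 2) * ∫ τ in Ioi (0 : ℝ), besselIntegrand β f n τ

end DiscreteBesov

end

/-! The weighted condition on `f` forces polynomial growth, so `f` lies in the Banach space of
functions bounded by a multiple of (5/4)^|n|. Translations are bounded there; hence Δ is bounded,
e^{tΔ} is an operator exponential smooth in t, and ∂_t^l e^{tΔ} = Δ^l e^{tΔ}. The weight grows
slowly enough that ‖e^{tΔ}‖ ≤ e^{t/2}, so the Bessel potential is a Bochner integral in this space.
`hasSum_heatKernel_mul` identifies the exponential with the kernel-defined semigroup.

Smoothing comes from a factorization. With U, V the shifts by ±1, UV = 1, so e^{tΔ} = e^{t(U-1)}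
e^{t(V-1)} and -Δ = (U-1)(V-1). Each factor averages over Poisson translates, and (U-1)e^{t(U-1)}
has coefficients of ℓ¹ norm at most t^{-1/2}, the Poisson variance bound `tsum_abs_poissonDiff_le`.
Thus ‖Δ^m e^{tΔ}‖ ≤ C t^{-m} on every ℓ^p.

For the seminorm, first raise the order of differentiation to l = ⌊(α+β)/2⌋+1. Put a = l - α/2 and
N(s) = s^a ‖Δ^l e^{sΔ} f‖_p. Minkowski and the substitution τ = tr bound the profile of the
potential at t by a multiple of ∫ r^{β/2}(1+r)^{-a} N((1+r)t) dr/r (`heatProfile_growthBessel_le`).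
A second Minkowski inequality and the dilation invariance of dt/t bound its L^q norm by that of N,
as the kernel is integrable for 0 < β/2 < a. The weighted condition passes to the potential by
Minkowski too: translates grow at most like (5/4)^|d| in the weighted norm, so e^{τΔ} grows like
e^{τ/2}, which e^{-τ} absorbs (`memLp_weighted_growthBessel`). -/

namespace DiscreteBesov

/-! ### Minkowski's integral inequality for extended nonnegative functions -/

section Minkowski

variable {X Y : Type*} [MeasurableSpace X] [MeasurableSpace Y]

/-- Hölder applied to F = (F c^{-1/Q}) c^{1/Q} bounds the inner integral for each x; after Tonelli,
the slice bound leaves c^P c^{-P/Q} = c. Cancelling negative powers of c is what requires it to be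
nonzero and almost everywhere finite. -/
theorem lintegral_rpow_lintegral_le {μ : Measure X} {ν : Measure Y} [SFinite μ] [SFinite ν]
    {F : X → Y → ℝ≥0∞} (hF : Measurable (Function.uncurry F)) {c : Y → ℝ≥0∞} (hc : Measurable c)
    {P Q : ℝ} (hPQ : P.HolderConjugate Q) (hc0 : ∀ y, c y ≠ 0) (hctop : ∀ᵐ y ∂ν, c y ≠ ∞)
    (h : ∀ᵐ y ∂ν, ∫⁻ x, F x y ^ P ∂μ ≤ c y ^ P) :
    ∫⁻ x, (∫⁻ y, F x y ∂ν) ^ P ∂μ ≤ (∫⁻ y, c y ∂ν) ^ P := by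
  have hP : 0 < P := hPQ.pos
  have hQ : 0 < Q := hPQ.symm.pos
  have hPQ1 : 1 + P / Q = P := by
    have := hPQ.inv_add_inv_eq_one
    field_simp at this ⊢
    linarith
  have key : ∀ x, (∫⁻ y, F x y ∂ν) ^ P ≤
      (∫⁻ y, F x y ^ P * c y ^ (-(P / Q)) ∂ν) * (∫⁻ y, c y ∂ν) ^ (P / Q) := by
    intro x
    have hFx : Measurable (F x) := hF.of_uncurry_left
    have h1 : ∫⁻ y, F x y ∂ν ≤ ∫⁻ y, (F x y * c y ^ (-(1 / Q))) * c y ^ (1 / Q) ∂ν := by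
      refine lintegral_mono_ae ?_
      filter_upwards [hctop] with y hy
      rw [mul_assoc, ← ENNReal.rpow_add _ _ (hc0 y) hy]
      simp
    have h2 := ENNReal.lintegral_mul_le_Lp_mul_Lq ν hPQ
      (f := fun y => F x y * c y ^ (-(1 / Q))) (g := fun y => c y ^ (1 / Q))
      (by fun_prop) (by fun_prop)
    calc (∫⁻ y, F x y ∂ν) ^ P ≤ _ := ENNReal.rpow_le_rpow (h1.trans h2) hP.le
      _ = _ := by
        rw [ENNReal.mul_rpow_of_nonneg _ _ hP.le, ← ENNReal.rpow_mul, ← ENNReal.rpow_mul,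
          one_div_mul_cancel hP.ne', ENNReal.rpow_one]
        congr 1
        · refine lintegral_congr fun y => ?_
          rw [ENNReal.mul_rpow_of_nonneg _ _ hP.le, ← ENNReal.rpow_mul]
          congr 2
          ring
        · congr 1
          · refine lintegral_congr fun y => ?_
            rw [← ENNReal.rpow_mul, one_div_mul_cancel hQ.ne', ENNReal.rpow_one]
          · ring
  have hFm : Measurable (Function.uncurry fun x y => F x y ^ P * c y ^ (-(P / Q))) :=
    (hF.pow_const P).mul ((hc.comp measurable_snd).pow_const _)
  calc ∫⁻ x, (∫⁻ y, F x y ∂ν) ^ P ∂μ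
      ≤ ∫⁻ x, (∫⁻ y, F x y ^ P * c y ^ (-(P / Q)) ∂ν) * (∫⁻ y, c y ∂ν) ^ (P / Q) ∂μ :=
        lintegral_mono key
    _ = (∫⁻ x, ∫⁻ y, F x y ^ P * c y ^ (-(P / Q)) ∂ν ∂μ) * (∫⁻ y, c y ∂ν) ^ (P / Q) :=
        lintegral_mul_const _ hFm.lintegral_prod_right
    _ = (∫⁻ y, ∫⁻ x, F x y ^ P * c y ^ (-(P / Q)) ∂μ ∂ν) * (∫⁻ y, c y ∂ν) ^ (P / Q) := by
        rw [lintegral_lintegral_swap hFm.aemeasurable]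
    _ ≤ (∫⁻ y, c y ∂ν) * (∫⁻ y, c y ∂ν) ^ (P / Q) := by
        gcongr ?_ * _
        refine lintegral_mono_ae ?_
        filter_upwards [h, hctop] with y hy hy'
        rw [lintegral_mul_const _ (hF.of_uncurry_right.pow_const P)]
        calc _ ≤ c y ^ P * c y ^ (-(P / Q)) := by gcongr
          _ = c y := by
            rw [← ENNReal.rpow_add _ _ (hc0 y) hy', ← sub_eq_add_neg,
              show P - P / Q = 1 by linarith, ENNReal.rpow_one]
    _ = (∫⁻ y, c y ∂ν) ^ P := by
        nth_rw 1 [← ENNReal.rpow_one (∫⁻ y, c y ∂ν)]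
        rw [← ENNReal.rpow_add_of_nonneg _ _ zero_le_one (by positivity), hPQ1]

/-- Minkowski's integral inequality, with a measurable majorant of the norms of the slices. -/
theorem eLpNorm_lintegral_le {μ : Measure X} {ν : Measure Y} [SFinite μ] [SigmaFinite ν]
    {F : X → Y → ℝ≥0∞} (hF : Measurable (Function.uncurry F)) {c : Y → ℝ≥0∞} (hc : Measurable c)
    {p : ℝ≥0∞} (hp : 1 ≤ p) (h : ∀ᵐ y ∂ν, eLpNorm (fun x => F x y) p μ ≤ c y) :
    eLpNorm (fun x => ∫⁻ y, F x y ∂ν) p μ ≤ ∫⁻ y, c y ∂ν := by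
  rcases eq_or_ne p ∞ with rfl | hptop
  · simp only [eLpNorm_exponent_top] at h ⊢
    have h1 : ∀ᵐ y ∂ν, ∀ᵐ x ∂μ, F x y ≤ c y := by
      filter_upwards [h] with y hy
      filter_upwards [enorm_ae_le_eLpNormEssSup (fun x => F x y) μ] with x hx
      exact hx.trans hy
    rw [Measure.ae_ae_comm (p := fun y x => F x y ≤ c y)
      (measurableSet_le (hF.comp measurable_swap) (hc.comp measurable_fst))] at h1
    refine eLpNormEssSup_le_of_ae_enorm_bound ?_
    filter_upwards [h1] with x hx
    exact lintegral_mono_ae hx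
  rcases hp.eq_or_lt with rfl | hp1
  · simp only [eLpNorm_one_eq_lintegral_enorm, enorm_eq_self] at h ⊢
    rw [lintegral_lintegral_swap hF.aemeasurable]
    exact lintegral_mono_ae h
  have hp0 : p ≠ 0 := (zero_lt_one.trans hp1).ne'
  have hP : 1 < p.toReal := by
    rw [← ENNReal.toReal_one]
    exact (ENNReal.toReal_lt_toReal ENNReal.one_ne_top hptop).2 hp1
  have hP0 : 0 < p.toReal := zero_lt_one.trans hP
  have hPQ := Real.HolderConjugate.conjExponent hP
  -- The majorant may vanish, so it is perturbed by a strictly positive function of integral below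
  -- ε, which exists by σ-finiteness.
  refine ENNReal.le_of_forall_pos_le_add fun ε hε hfin => ?_
  obtain ⟨d, hd0, hdm, hdε⟩ := exists_pos_lintegral_lt_of_sigmaFinite ν
    (ENNReal.coe_ne_zero.2 hε.ne')
  have hle : ∫⁻ y, (c y + d y) ∂ν ≤ ∫⁻ y, c y ∂ν + ε := by
    rw [lintegral_add_left hc]
    gcongr
  refine le_trans ?_ hle
  rw [eLpNorm_eq_lintegral_rpow_enorm_toReal hp0 hptop, one_div, ENNReal.rpow_inv_le_iff hP0]
  simp only [enorm_eq_self]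
  refine lintegral_rpow_lintegral_le hF (hc.add hdm.coe_nnreal_ennreal) hPQ
    (fun y => ?_) ?_ ?_
  · simp [(hd0 y).ne']
  · filter_upwards [ae_lt_top hc hfin.ne] with y hy
    exact ENNReal.add_ne_top.2 ⟨hy.ne, ENNReal.coe_ne_top⟩
  · filter_upwards [h] with y hy
    rw [eLpNorm_eq_lintegral_rpow_enorm_toReal hp0 hptop, one_div,
      ENNReal.rpow_inv_le_iff hP0] at hy
    simp only [enorm_eq_self] at hy
    exact hy.trans (by gcongr; exact le_self_add)

theorem measurable_eLpNorm_count {u : Y → ℤ → ℝ} (hu : ∀ n, Measurable fun y => u y n)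
    (p : ℝ≥0∞) : Measurable fun y => eLpNorm (u y) p Measure.count := by
  rcases eq_or_ne p 0 with rfl | hp0
  · simp
  rcases eq_or_ne p ∞ with rfl | hptop
  · simp only [eLpNorm_exponent_top, eLpNormEssSup, essSup_count]
    exact Measurable.iSup fun n => (hu n).enorm
  · simp only [eLpNorm_eq_lintegral_rpow_enorm_toReal hp0 hptop, lintegral_count]
    exact (Measurable.tsum fun n => (hu n).enorm.pow_const _).pow_const _

/-- Weighted `ℓ^p` bound for a superposition of transforms of one function. -/
theorem eLpNorm_le_tsum_mul {ι : Type*} [Countable ι] {μ : Measure ℤ} [SFinite μ] {p : ℝ≥0∞}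
    (hp : 1 ≤ p) {g : ℤ → ℝ≥0∞} {k : ι → ℝ≥0∞} {F : ι → ℤ → ℝ≥0∞} {c : ι → ℝ≥0∞}
    (hg : ∀ n, g n ≤ ∑' i, k i * F i n) (hF : ∀ i, eLpNorm (F i) p μ ≤ c i) :
    eLpNorm g p μ ≤ ∑' i, k i * c i := by
  -- With the discrete σ-algebra the sum is an integral against counting measure, and Minkowski
  -- applies.
  let _ : MeasurableSpace ι := ⊤
  have : DiscreteMeasurableSpace ι := ⟨fun _ => trivial⟩
  have h := eLpNorm_lintegral_le (μ := μ) (ν := Measure.count) (F := fun n i => k i * F i n)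
    (c := fun i => k i * c i) (.of_discrete) (.of_discrete) hp (.of_forall fun i => ?_)
  · simp only [lintegral_count] at h
    refine le_trans (eLpNorm_mono_enorm fun n => ?_) h
    simpa using hg n
  · exact (eLpNorm_le_mul_eLpNorm_of_ae_le_mul'' (c := k i) (g := F i) p .of_discrete
      (.of_forall fun n => by simp)).trans
      (by gcongr; exact hF i)

end Minkowski

/-! ### The dilation-invariant measure dt/t -/

section MultMeasure

instance : SigmaFinite multMeasure := by
  unfold multMeasure
  infer_instance

theorem lintegral_multMeasure {ψ : ℝ → ℝ≥0∞} (hψ : Measurable ψ) :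
    ∫⁻ t, ψ t ∂multMeasure = ∫⁻ t in Ioi 0, ENNReal.ofReal (1 / t) * ψ t := by
  rw [multMeasure, lintegral_withDensity_eq_lintegral_mul _ (by fun_prop) hψ]
  rfl

theorem ae_multMeasure_pos : ∀ᵐ t ∂multMeasure, 0 < t :=
  (withDensity_absolutelyContinuous _ _).ae_le (ae_restrict_mem measurableSet_Ioi)

theorem lintegral_multMeasure_comp_mul_left {c : ℝ} (hc : 0 < c) {ψ : ℝ → ℝ≥0∞}
    (hψ : Measurable ψ) : ∫⁻ t, ψ (c * t) ∂multMeasure = ∫⁻ t, ψ t ∂multMeasure := by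
  rw [lintegral_multMeasure hψ, lintegral_multMeasure (ψ := fun t => ψ (c * t)) (by fun_prop),
    ← lintegral_indicator measurableSet_Ioi, ← lintegral_indicator measurableSet_Ioi]
  set H : ℝ → ℝ≥0∞ := (Ioi (0 : ℝ)).indicator fun t => ENNReal.ofReal (1 / t) * ψ t with hH
  have hHm : Measurable H := Measurable.indicator (by fun_prop) measurableSet_Ioi
  have h1 : ∀ t, (Ioi (0 : ℝ)).indicator (fun t => ENNReal.ofReal (1 / t) * ψ (c * t)) t =
      ENNReal.ofReal c * H (c * t) := by
    intro t
    by_cases ht : 0 < t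
    · rw [hH, indicator_of_mem (mem_Ioi.2 ht), indicator_of_mem (mem_Ioi.2 (mul_pos hc ht)),
        ← mul_assoc, ← ENNReal.ofReal_mul hc.le]
      congr 2
      field_simp
    · rw [hH, indicator_of_notMem (by simpa using ht),
        indicator_of_notMem (by simpa using mul_nonpos_of_nonneg_of_nonpos hc.le (not_lt.1 ht)),
        mul_zero]
  simp only [h1]
  rw [lintegral_const_mul (f := fun t => H (c * t)) _ (by fun_prop),
    ← lintegral_map hHm (measurable_const_mul c), Real.map_volume_mul_left hc.ne',
    lintegral_smul_measure, smul_eq_mul, ← mul_assoc, ← ENNReal.ofReal_mul hc.le,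
    abs_of_pos (inv_pos.2 hc), mul_inv_cancel₀ hc.ne', ENNReal.ofReal_one, one_mul]

theorem measurePreserving_mul_left_multMeasure {c : ℝ} (hc : 0 < c) :
    MeasurePreserving (fun t => c * t) multMeasure multMeasure := by
  refine ⟨measurable_const_mul c, ?_⟩
  ext s hs
  rw [Measure.map_apply (measurable_const_mul c) hs, ← lintegral_indicator_one hs,
    ← lintegral_multMeasure_comp_mul_left hc (measurable_one.indicator hs),
    ← lintegral_indicator_one ((measurable_const_mul c) hs)]
  rfl

/-- Comparison with r^{a-1} on (0,1] and with r^{a-b-1} on (1,∞). This is the total mass of the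
kernel that controls the Bessel potential in the Besov seminorm. -/
theorem lintegral_rpow_mul_one_add_rpow_lt_top {a b : ℝ} (ha : 0 < a) (hab : a < b) :
    ∫⁻ r, ENNReal.ofReal (r ^ a * (1 + r) ^ (-b)) ∂multMeasure < ∞ := by
  rw [lintegral_multMeasure (by fun_prop), ← Ioc_union_Ioi_eq_Ioi (zero_le_one' ℝ)]
  refine (lintegral_union_le _ _ _).trans_lt (ENNReal.add_lt_top.2 ⟨?_, ?_⟩)
  · have h : IntegrableOn (fun r : ℝ => r ^ (a - 1)) (Ioc 0 1) :=
      (intervalIntegrable_iff_integrableOn_Ioc_of_le zero_le_one).1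
        (intervalIntegral.intervalIntegrable_rpow' (by linarith))
    refine (setLIntegral_mono' measurableSet_Ioc fun r hr => ?_).trans_lt h.lintegral_lt_top
    have hr0 : 0 < r := hr.1
    rw [← ENNReal.ofReal_mul (by positivity)]
    refine ENNReal.ofReal_le_ofReal ?_
    rw [Real.rpow_sub_one hr0.ne']
    have : (1 + r) ^ (-b) ≤ 1 :=
      Real.rpow_le_one_of_one_le_of_nonpos (by linarith) (by linarith)
    calc 1 / r * (r ^ a * (1 + r) ^ (-b)) ≤ 1 / r * (r ^ a * 1) := by gcongr
      _ = r ^ a / r := by ring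
  · have h : IntegrableOn (fun r : ℝ => r ^ (a - b - 1)) (Ioi 1) :=
      integrableOn_Ioi_rpow_of_lt (by linarith) one_pos
    refine (setLIntegral_mono' measurableSet_Ioi fun r hr => ?_).trans_lt h.lintegral_lt_top
    have hr0 : 0 < r := one_pos.trans hr
    rw [← ENNReal.ofReal_mul (by positivity)]
    refine ENNReal.ofReal_le_ofReal ?_
    rw [Real.rpow_sub_one hr0.ne', sub_eq_add_neg, Real.rpow_add hr0]
    have : (1 + r) ^ (-b) ≤ r ^ (-b) :=
      Real.rpow_le_rpow_of_nonpos hr0 (by linarith) (by linarith)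
    calc 1 / r * (r ^ a * (1 + r) ^ (-b)) ≤ 1 / r * (r ^ a * r ^ (-b)) := by gcongr
      _ = r ^ a * r ^ (-b) / r := by ring

end MultMeasure

/-! ### Atoms and translates of the measure μ -/

section WeightMeasure

instance : SFinite weightMeasure := by
  unfold weightMeasure
  infer_instance

theorem weightMeasure_singleton (n : ℤ) :
    weightMeasure {n} = ENNReal.ofReal (1 / (1 + |(n : ℝ)|)) := by
  rw [weightMeasure, Measure.sum_apply _ (measurableSet_singleton n), tsum_eq_single n]
  · simp
  · intro m hm
    simp [hm]

/-- Restrict the norm to the atom at n. Its mass is at most 1, so mass^{1/q} is at least the mass,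
and one constant serves every q, including ∞. -/
theorem enorm_le_eLpNorm_weightMeasure {q : ℝ≥0∞} (hq : 1 ≤ q) (ψ : ℤ → ℝ) (n : ℤ) :
    ‖ψ n‖ₑ ≤ ENNReal.ofReal (1 + |(n : ℝ)|) * eLpNorm ψ q weightMeasure := by
  have hn : (0 : ℝ) < 1 + |(n : ℝ)| := by positivity
  set x := ENNReal.ofReal (1 / (1 + |(n : ℝ)|)) with hx
  have hx0 : x ≠ 0 := by simpa [hx] using hn
  have hx1 : x ≤ 1 := by
    rw [hx, ENNReal.ofReal_le_one, div_le_one hn]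
    simp
  have h1 : x * ‖ψ n‖ₑ ≤ eLpNorm ψ q weightMeasure := by
    refine le_trans ?_ (eLpNorm_mono_measure ψ (Measure.restrict_le_self (s := {n})))
    rw [Measure.restrict_singleton, weightMeasure_singleton,
      eLpNorm_smul_measure_of_ne_zero hx0]
    have h2 : eLpNorm ψ q (Measure.dirac n) = ‖ψ n‖ₑ := by
      have : ψ =ᵐ[Measure.dirac n] fun _ => ψ n := by
        rw [Filter.EventuallyEq, ae_dirac_iff .of_discrete]
      rw [eLpNorm_congr_ae this, eLpNorm_const _ (zero_lt_one.trans_le hq).ne'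
        (by simp)]
      simp
    rw [h2, smul_eq_mul]
    gcongr
    conv_lhs => rw [← ENNReal.rpow_one x]
    refine ENNReal.rpow_le_rpow_of_exponent_ge hx1 ?_
    rw [← ENNReal.toReal_one]
    refine ENNReal.toReal_mono ENNReal.one_ne_top ?_
    simpa using hq
  calc ‖ψ n‖ₑ = ENNReal.ofReal (1 + |(n : ℝ)|) * (x * ‖ψ n‖ₑ) := by
        rw [← mul_assoc, hx, ← ENNReal.ofReal_mul hn.le, mul_one_div_cancel hn.ne',
          ENNReal.ofReal_one, one_mul]
    _ ≤ _ := by gcongr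

/-- On atoms this is 1+|n| ≤ (1+|n-j|)(1+|j|). -/
theorem map_add_weightMeasure_le (j : ℤ) :
    weightMeasure.map (fun n => n + j) ≤ ENNReal.ofReal (1 + |(j : ℝ)|) • weightMeasure := by
  rw [Measure.le_iff]
  intro s _
  rw [← Measure.tsum_indicator_apply_singleton _ s .of_discrete,
    ← Measure.tsum_indicator_apply_singleton _ s .of_discrete]
  refine ENNReal.tsum_le_tsum fun n => indicator_le_indicator ?_
  have : (fun n : ℤ => n + j) ⁻¹' {n} = {n - j} := by
    ext m
    simp only [mem_preimage, mem_singleton_iff]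
    lia
  rw [Measure.map_apply (.of_discrete) (measurableSet_singleton n), this, weightMeasure_singleton,
    Measure.smul_apply, weightMeasure_singleton, smul_eq_mul,
    ← ENNReal.ofReal_mul (by positivity)]
  refine ENNReal.ofReal_le_ofReal ?_
  rw [mul_one_div, div_le_div_iff₀ (by positivity) (by positivity)]
  have h1 : |(n : ℝ)| ≤ |((n - j : ℤ) : ℝ)| + |(j : ℝ)| := by
    push_cast
    simpa using abs_add_le ((n : ℝ) - j) j
  nlinarith [abs_nonneg ((n - j : ℤ) : ℝ), abs_nonneg (j : ℝ)]

theorem eLpNorm_comp_add_weightMeasure_le {q : ℝ≥0∞} (hq : 1 ≤ q) (ψ : ℤ → ℝ) (j : ℤ) :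
    eLpNorm (fun n => ψ (n + j)) q weightMeasure ≤
      ENNReal.ofReal (1 + |(j : ℝ)|) * eLpNorm ψ q weightMeasure := by
  set x := ENNReal.ofReal (1 + |(j : ℝ)|) with hx
  have hx1 : 1 ≤ x := by
    rw [hx, ENNReal.one_le_ofReal]
    simp
  calc eLpNorm (fun n => ψ (n + j)) q weightMeasure
      = eLpNorm ψ q (weightMeasure.map fun n => n + j) :=
        (eLpNorm_map_measure .of_discrete (Measurable.of_discrete.aemeasurable)).symm
    _ ≤ eLpNorm ψ q (x • weightMeasure) := eLpNorm_mono_measure _ (map_add_weightMeasure_le j)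
    _ = x ^ (1 / q).toReal * eLpNorm ψ q weightMeasure :=
        eLpNorm_smul_measure_of_ne_zero (zero_lt_one.trans_le hx1).ne' _ _ _
    _ ≤ x * eLpNorm ψ q weightMeasure := by
        gcongr
        conv_rhs => rw [← ENNReal.rpow_one x]
        refine ENNReal.rpow_le_rpow_of_exponent_le hx1 ?_
        rw [← ENNReal.toReal_one]
        refine ENNReal.toReal_mono ENNReal.one_ne_top ?_
        simpa using hq

end WeightMeasure

/-! ### Poisson averages in a Banach algebra -/

section Poisson

/-- The mass `e^{-t} t^a / a!` of the Poisson law of parameter `t` at `a`. -/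
noncomputable def poissonMass (t : ℝ) (a : ℕ) : ℝ := Real.exp (-t) * (t ^ a / (a ! : ℝ))

theorem poissonMass_nonneg {t : ℝ} (ht : 0 ≤ t) (a : ℕ) : 0 ≤ poissonMass t a := by
  unfold poissonMass
  positivity

theorem poissonMass_succ {t : ℝ} (ht : t ≠ 0) (a : ℕ) :
    poissonMass t (a + 1) * (((a + 1 : ℕ) : ℝ) / t) = poissonMass t a := by
  have := Nat.cast_ne_zero (R := ℝ) |>.2 (Nat.factorial_ne_zero a)
  unfold poissonMass
  rw [Nat.factorial_succ]
  push_cast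
  field_simp
  ring

variable {A : Type*} [NormedRing A] [NormedAlgebra ℝ A]

theorem hasSum_poissonMass_smul_pow [CompleteSpace A] (t : ℝ) (U : A) :
    HasSum (fun a => poissonMass t a • U ^ a) (Real.exp (-t) • NormedSpace.exp (t • U)) := by
  have h := (NormedSpace.exp_series_hasSum_exp' (𝕂 := ℝ) (t • U)).const_smul (Real.exp (-t))
  convert h using 1
  ext a
  rw [poissonMass, mul_smul, smul_pow, smul_smul _ (t ^ a), div_eq_inv_mul]

theorem summable_norm_poissonMass_smul_pow (t : ℝ) (U : A) :
    Summable fun a => ‖poissonMass t a • U ^ a‖ := by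
  have h := (NormedSpace.norm_expSeries_summable' (𝕂 := ℝ) (t • U)).mul_left (Real.exp (-t))
  refine h.congr fun a => ?_
  rw [poissonMass, mul_smul, norm_smul _ ((t ^ a / (a ! : ℝ)) • U ^ a), Real.norm_eq_abs,
    Real.abs_exp, smul_pow, smul_smul, div_eq_inv_mul]

theorem hasSum_poissonMass_mul_pow (t r : ℝ) :
    HasSum (fun a => poissonMass t a * r ^ a) (Real.exp (t * (r - 1))) := by
  have h := hasSum_poissonMass_smul_pow t r
  rw [smul_eq_mul, ← Real.exp_eq_exp_ℝ, ← Real.exp_add, smul_eq_mul] at h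
  simpa [smul_eq_mul, show -t + t * r = t * (r - 1) by ring] using h

theorem hasSum_poissonMass (t : ℝ) : HasSum (poissonMass t) 1 := by
  simpa using hasSum_poissonMass_mul_pow t 1

/-- The mass function `p(a)(a/t-1)`, which is the discrete derivative of the Poisson mass. -/
noncomputable def poissonDiff (t : ℝ) (a : ℕ) : ℝ := poissonMass t a * (a / t - 1)

/-- Multiplication by U shifts the Poisson series by one index, turning the mass p(a) into p(a-1) =
p(a) a/t; subtracting the original series leaves the factor a/t - 1. -/
theorem hasSum_poissonDiff_smul_pow [CompleteSpace A] {t : ℝ} (ht : t ≠ 0) (U : A) :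
    HasSum (fun a => poissonDiff t a • U ^ a)
      ((U - 1) * Real.exp (-t) • NormedSpace.exp (t • U)) := by
  have h := hasSum_poissonMass_smul_pow t U
  have h1 : HasSum (fun a : ℕ => (poissonMass t a * (a / t)) • U ^ a)
      (U * Real.exp (-t) • NormedSpace.exp (t • U)) := by
    rw [← hasSum_nat_add_iff' 1]
    simpa [poissonMass_succ ht, pow_succ', -Nat.cast_add] using h.mul_left U
  rw [sub_mul, one_mul]
  simpa only [poissonDiff, mul_sub, mul_one, sub_smul] using h1.sub h


theorem summable_norm_poissonDiff_smul_pow {t : ℝ} (ht : t ≠ 0) (U : A) :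
    Summable fun a => ‖poissonDiff t a • U ^ a‖ := by
  have h := summable_norm_poissonMass_smul_pow t U
  have h1 : Summable fun a : ℕ => ‖(poissonMass t a * (a / t)) • U ^ a‖ := by
    rw [← summable_nat_add_iff 1]
    refine Summable.of_nonneg_of_le (fun _ => norm_nonneg _) (fun a => ?_) (h.mul_left ‖U‖)
    rw [poissonMass_succ ht, pow_succ', ← mul_smul_comm]
    exact norm_mul_le _ _
  refine Summable.of_nonneg_of_le (fun _ => norm_nonneg _) (fun a => ?_) (h1.add h)
  rw [poissonDiff, mul_sub, mul_one, sub_smul]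
  exact norm_sub_le _ _

/-- The variance t of the Poisson law divided by t², computed from the first two moments of a/t,
namely 1 and 1 + 1/t. -/
theorem hasSum_poissonMass_mul_sq {t : ℝ} (ht : t ≠ 0) :
    HasSum (fun a : ℕ => poissonMass t a * (a / t - 1) ^ 2) (1 / t) := by
  have h0 := hasSum_poissonMass t
  have h1 : HasSum (fun a : ℕ => poissonMass t a * (a / t)) 1 := by
    rw [← hasSum_nat_add_iff' 1]
    simpa [poissonMass_succ ht, -Nat.cast_add] using h0
  have h2 : HasSum (fun a : ℕ => poissonMass t a * (a / t) * (a / t)) (1 + 1 / t) := by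
    rw [← hasSum_nat_add_iff' 1]
    have h3 := h1.add (h0.mul_right (1 / t))
    simp only [poissonMass_succ ht]
    have h4 : ∀ a : ℕ, poissonMass t a * (((a + 1 : ℕ) : ℝ) / t) =
      poissonMass t a * (a / t) + poissonMass t a * (1 / t) := fun a => by push_cast; ring
    simpa [h4, -Nat.cast_add] using h3
  have h := (h2.sub (h1.mul_left 2)).add h0
  rw [show 1 + 1 / t - 2 * 1 + 1 = 1 / t by ring] at h
  have e : ∀ a : ℕ, poissonMass t a * (a / t - 1) ^ 2 = poissonMass t a * (a / t) * (a / t) -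
    2 * (poissonMass t a * (a / t)) + poissonMass t a := fun a => by ring
  simpa only [e] using h

theorem summable_abs_poissonDiff {t : ℝ} (ht : 0 < t) : Summable fun a => |poissonDiff t a| := by
  simpa using summable_norm_poissonDiff_smul_pow ht.ne' (1 : ℝ)

/-- The mean absolute deviation is at most the standard deviation. Instead of Cauchy–Schwarz,
Young's inequality |x| ≤ (√t/2)x² + 1/(2√t) is summed; its weight √t balances the two resulting
terms. -/
theorem tsum_abs_poissonDiff_le {t : ℝ} (ht : 0 < t) :
    ∑' a, |poissonDiff t a| ≤ 1 / √t := by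
  have hs : 0 < √t := Real.sqrt_pos.2 ht
  have h := ((hasSum_poissonMass_mul_sq ht.ne').mul_left (√t / 2)).add
    ((hasSum_poissonMass t).mul_left (1 / (2 * √t)))
  have hval : √t / 2 * (1 / t) + 1 / (2 * √t) * 1 = 1 / √t := by
    nth_rw 2 [← Real.mul_self_sqrt ht.le]
    field_simp
    norm_num
  rw [hval] at h
  refine hasSum_le (fun a => ?_) (summable_abs_poissonDiff ht).hasSum h
  have hp := poissonMass_nonneg ht.le a
  rw [poissonDiff, abs_mul, abs_of_nonneg hp]
  have key : |a / t - 1| ≤ √t / 2 * (a / t - 1) ^ 2 + 1 / (2 * √t) := by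
    have h1 : √t / 2 * (a / t - 1) ^ 2 + 1 / (2 * √t) - |a / t - 1| =
        (√t * |a / t - 1| - 1) ^ 2 / (2 * √t) := by
      rw [← sq_abs (a / t - 1)]
      field_simp
      ring
    have h2 : 0 ≤ (√t * |a / t - 1| - 1) ^ 2 / (2 * √t) := by positivity
    linarith
  calc poissonMass t a * |a / t - 1|
      ≤ poissonMass t a * (√t / 2 * (a / t - 1) ^ 2 + 1 / (2 * √t)) := by gcongr
    _ = _ := by ring

theorem hasSum_smul_pow_mul_smul_pow [CompleteSpace A] {x y : ℕ → ℝ} {U V S R : A}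
    (hx : HasSum (fun a => x a • U ^ a) S) (hx' : Summable fun a => ‖x a • U ^ a‖)
    (hy : HasSum (fun a => y a • V ^ a) R) (hy' : Summable fun a => ‖y a • V ^ a‖) :
    HasSum (fun z : ℕ × ℕ => (x z.1 * y z.2) • (U ^ z.1 * V ^ z.2)) (S * R) := by
  have h : Summable fun z : ℕ × ℕ => (x z.1 • U ^ z.1) * (y z.2 • V ^ z.2) :=
    summable_mul_of_summable_norm (f := fun a => x a • U ^ a) (g := fun a => y a • V ^ a) hx' hy'
  simpa only [smul_mul_smul_comm] using hx.mul hy h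

theorem exp_add_smul [CompleteSpace A] (s t : ℝ) (T : A) :
    NormedSpace.exp ((s + t) • T) = NormedSpace.exp (s • T) * NormedSpace.exp (t • T) := by
  let _ : NormedAlgebra ℚ A := NormedAlgebra.restrictScalars ℚ ℝ A
  rw [add_smul, NormedSpace.exp_add_of_commute (((Commute.refl T).smul_left s).smul_right t)]

theorem exp_smul_add_sub_two [CompleteSpace A] (t : ℝ) {U V : A} (hUV : Commute U V) :
    NormedSpace.exp (t • (U + V - (2 : ℝ) • 1)) =
      (Real.exp (-t) • NormedSpace.exp (t • U)) * (Real.exp (-t) • NormedSpace.exp (t • V)) := by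
  let _ : NormedAlgebra ℚ A := NormedAlgebra.restrictScalars ℚ ℝ A
  have h1 : t • (U + V - (2 : ℝ) • 1) = t • U + t • V + (-(2 * t)) • (1 : A) := by
    module
  have h2 : NormedSpace.exp ((-(2 * t)) • (1 : A)) = Real.exp (-(2 * t)) • 1 := by
    rw [← Algebra.algebraMap_eq_smul_one, ← NormedSpace.algebraMap_exp_comm,
      Algebra.algebraMap_eq_smul_one, Real.exp_eq_exp_ℝ]
  have h3 : Commute (t • U + t • V) ((-(2 * t)) • (1 : A)) := (Commute.one_right _).smul_right _
  have h4 : Commute (t • U) (t • V) := (hUV.smul_left t).smul_right t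
  have h5 : Real.exp (-t) * Real.exp (-t) = Real.exp (-(2 * t)) := by
    rw [← Real.exp_add]
    ring_nf
  rw [h1, NormedSpace.exp_add_of_commute h3, NormedSpace.exp_add_of_commute h4, h2,
    smul_mul_smul_comm, h5, mul_smul_comm, mul_one]

theorem commute_exp_smul (t : ℝ) {U V : A} (hUV : Commute U V) :
    Commute U (NormedSpace.exp (t • V)) :=
  (hUV.smul_right t).exp_right

/-- Since UV = 1, (U-1)(V-1) = 2-U-V: the generator splits into one difference for each one-sided
exponential, so each difference can be absorbed at cost t^{-1/2}. -/
theorem sub_one_mul_exp_mul_sub_one_mul_exp [CompleteSpace A] (t : ℝ) {U V : A} (h1 : U * V = 1)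
    (h2 : V * U = 1) :
    (U - 1) * Real.exp (-t) • NormedSpace.exp (t • U) *
        ((V - 1) * Real.exp (-t) • NormedSpace.exp (t • V)) =
      -((U + V - (2 : ℝ) • 1) * NormedSpace.exp (t • (U + V - (2 : ℝ) • 1))) := by
  have hUV : Commute U V := h1.trans h2.symm
  have hc : Commute (V - 1) (Real.exp (-t) • NormedSpace.exp (t • U)) :=
    (commute_exp_smul t (hUV.symm.sub_left (Commute.one_left U))).smul_right _
  have h3 : -(U + V - (2 : ℝ) • 1) = (U - 1) * (V - 1) := by
    rw [sub_mul, mul_sub, h1, one_mul, mul_one]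
    module
  rw [exp_smul_add_sub_two t hUV, ← neg_mul, h3, mul_assoc, ← mul_assoc _ (V - 1), ← hc.eq]
  simp only [mul_assoc]

end Poisson

/-! ### The heat semigroup on functions of exponential growth -/

section GrowthSpace

/-- The weight `(5/4)^{|n|}`. -/
noncomputable def growthWeight (n : ℤ) : ℝ := (5 / 4) ^ n.natAbs

theorem growthWeight_pos (n : ℤ) : 0 < growthWeight n := by
  unfold growthWeight
  positivity

theorem growthWeight_add_le (m n : ℤ) : growthWeight (m + n) ≤ growthWeight m * growthWeight n := by
  rw [growthWeight, growthWeight, growthWeight, ← pow_add]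
  exact pow_le_pow_right₀ (by norm_num) (Int.natAbs_add_le m n)

/-- The space of functions `n ↦ (5/4)^{|n|} h(n)` with `h` bounded, represented by `h`. -/
def GrowthSpace : Type := lp (fun _ : ℤ => ℝ) ∞

noncomputable instance : NormedAddCommGroup GrowthSpace :=
  inferInstanceAs (NormedAddCommGroup (lp (fun _ : ℤ => ℝ) ∞))

noncomputable instance : NormedSpace ℝ GrowthSpace :=
  inferInstanceAs (NormedSpace ℝ (lp (fun _ : ℤ => ℝ) ∞))

instance : CompleteSpace GrowthSpace :=
  inferInstanceAs (CompleteSpace (lp (fun _ : ℤ => ℝ) ∞))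

instance : CoeFun GrowthSpace fun _ => ℤ → ℝ :=
  ⟨fun h => h.1⟩

/-- The value at `n` of the function `n ↦ (5/4)^{|n|} h(n)` represented by `h`. -/
noncomputable def growthEval (n : ℤ) : GrowthSpace →L[ℝ] ℝ :=
  growthWeight n • (lp.evalCLM ℝ (fun _ : ℤ => ℝ) ∞ n : lp (fun _ : ℤ => ℝ) ∞ →L[ℝ] ℝ)

theorem growthEval_apply (n : ℤ) (h : GrowthSpace) : growthEval n h = growthWeight n * h n := rfl

theorem growthEval_ext {g h : GrowthSpace} (H : ∀ n, growthEval n g = growthEval n h) : g = h := by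
  refine lp.ext (funext fun n => ?_)
  exact mul_left_cancel₀ (growthWeight_pos n).ne' (H n)

theorem exists_growthEval_eq {f : ℤ → ℝ} {C : ℝ} (hf : ∀ n, |f n| ≤ C * growthWeight n) :
    ∃ h : GrowthSpace, ∀ n, growthEval n h = f n := by
  refine ⟨⟨fun n => (growthWeight n)⁻¹ * f n, memℓp_infty ⟨C, ?_⟩⟩, fun n => ?_⟩
  · rintro _ ⟨n, rfl⟩
    have h0 := growthWeight_pos n
    change ‖(growthWeight n)⁻¹ * f n‖ ≤ C
    rw [Real.norm_eq_abs, abs_mul, abs_of_pos (inv_pos.2 h0), inv_mul_le_iff₀ h0, mul_comm]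
    exact hf n
  · exact mul_inv_cancel_left₀ (growthWeight_pos n).ne' _

theorem norm_growthWeight_div_mul_le (e n : ℤ) (h : GrowthSpace) :
    ‖growthWeight (n + e) / growthWeight n * h (n + e)‖ ≤ growthWeight e * ‖h‖ := by
  have h0 := growthWeight_pos n
  have h1 := growthWeight_pos (n + e)
  rw [norm_mul, Real.norm_eq_abs, abs_of_pos (div_pos h1 h0)]
  have h2 : growthWeight (n + e) / growthWeight n ≤ growthWeight e := by
    rw [div_le_iff₀ h0, mul_comm]
    exact growthWeight_add_le n e
  have : ‖h (n + e)‖ ≤ ‖h‖ := lp.norm_apply_le_norm ENNReal.top_ne_zero h (n + e)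
  have := growthWeight_pos e
  gcongr

/-- The translation `f ↦ f(· + e)` in the growth space. -/
noncomputable def growthShift (e : ℤ) : GrowthSpace →L[ℝ] GrowthSpace :=
  LinearMap.mkContinuous
    { toFun := fun h => ⟨fun n => growthWeight (n + e) / growthWeight n * h (n + e),
        memℓp_infty ⟨growthWeight e * ‖h‖, by
          rintro _ ⟨n, rfl⟩
          exact norm_growthWeight_div_mul_le e n h⟩⟩
      map_add' := fun _ _ => lp.ext (funext fun _ => mul_add _ _ _)
      map_smul' := fun _ _ => lp.ext (funext fun _ => mul_left_comm _ _ _) }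
    (growthWeight e) fun h =>
      lp.norm_le_of_forall_le (mul_nonneg (growthWeight_pos e).le (norm_nonneg h))
        fun n => norm_growthWeight_div_mul_le e n h

theorem growthEval_growthShift (e n : ℤ) (h : GrowthSpace) :
    growthEval n (growthShift e h) = growthEval (n + e) h := by
  have : growthShift e h n = growthWeight (n + e) / growthWeight n * h (n + e) := rfl
  rw [growthEval_apply, growthEval_apply, this]
  have := (growthWeight_pos n).ne'
  field_simp

theorem norm_growthShift_le (e : ℤ) : ‖growthShift e‖ ≤ growthWeight e :=
  LinearMap.mkContinuous_norm_le _ (growthWeight_pos e).le _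

theorem growthShift_zero : growthShift 0 = 1 := by
  ext1 h
  refine growthEval_ext fun n => ?_
  simp [growthEval_growthShift]

theorem growthShift_mul (d e : ℤ) : growthShift d * growthShift e = growthShift (d + e) := by
  ext1 h
  refine growthEval_ext fun n => ?_
  simp [growthEval_growthShift, add_assoc]

theorem growthShift_pow (e : ℤ) (a : ℕ) : growthShift e ^ a = growthShift (a * e) := by
  induction a with
  | zero => simp [growthShift_zero]
  | succ a ih => rw [pow_succ, ih, growthShift_mul]; push_cast; ring_nf

theorem commute_growthShift (d e : ℤ) : Commute (growthShift d) (growthShift e) := by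
  rw [Commute, SemiconjBy, growthShift_mul, growthShift_mul, add_comm]

/-- The discrete Laplacian on the growth space. -/
noncomputable def growthLaplacian : GrowthSpace →L[ℝ] GrowthSpace :=
  growthShift 1 + growthShift (-1) - (2 : ℝ) • 1

/-- The heat semigroup on the growth space. -/
noncomputable def growthHeat (t : ℝ) : GrowthSpace →L[ℝ] GrowthSpace :=
  NormedSpace.exp (t • growthLaplacian)

/-- The one-sided factor of the heat semigroup: averaging over Poisson translates. -/
noncomputable def poissonOp (t : ℝ) (e : ℤ) : GrowthSpace →L[ℝ] GrowthSpace :=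
  Real.exp (-t) • NormedSpace.exp (t • growthShift e)

theorem growthHeat_eq_mul (t : ℝ) : growthHeat t = poissonOp t 1 * poissonOp t (-1) :=
  exp_smul_add_sub_two t (commute_growthShift 1 (-1))

theorem growthHeat_add (s t : ℝ) : growthHeat (s + t) = growthHeat s * growthHeat t :=
  exp_add_smul s t growthLaplacian

theorem commute_growthLaplacian_growthHeat (t : ℝ) : Commute growthLaplacian (growthHeat t) :=
  commute_exp_smul t (Commute.refl growthLaplacian)

theorem hasDerivAt_growthHeat (t : ℝ) :
    HasDerivAt growthHeat (growthLaplacian * growthHeat t) t :=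
  hasDerivAt_exp_smul_const' growthLaplacian t

theorem continuous_growthHeat : Continuous growthHeat :=
  continuous_iff_continuousAt.2 fun t => (hasDerivAt_growthHeat t).continuousAt

theorem norm_poissonOp_le {t : ℝ} (ht : 0 ≤ t) {e : ℤ} (he : e.natAbs = 1) :
    ‖poissonOp t e‖ ≤ Real.exp (t / 4) := by
  have h := hasSum_poissonMass_mul_pow t (5 / 4)
  rw [show t * (5 / 4 - 1) = t / 4 by ring] at h
  refine (hasSum_poissonMass_smul_pow t (growthShift e)).norm_le_of_bounded h fun a => ?_
  rw [norm_smul, Real.norm_eq_abs, abs_of_nonneg (poissonMass_nonneg ht a), growthShift_pow]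
  have := norm_growthShift_le (a * e)
  rw [growthWeight, Int.natAbs_mul, he, Int.natAbs_natCast, mul_one] at this
  exact mul_le_mul_of_nonneg_left this (poissonMass_nonneg ht a)

/-- Each one-sided factor contributes the rate 5/4 - 1. The total 1/2 must stay below 1 for e^{-τ}
to win in the Bessel integral; any weight base strictly between 1 and 3/2 would serve. -/
theorem norm_growthHeat_le {t : ℝ} (ht : 0 ≤ t) : ‖growthHeat t‖ ≤ Real.exp (t / 2) := by
  rw [growthHeat_eq_mul, show t / 2 = t / 4 + t / 4 by ring, Real.exp_add]
  exact (norm_mul_le _ _).trans (mul_le_mul (norm_poissonOp_le ht rfl) (norm_poissonOp_le ht rfl)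
    (norm_nonneg _) (Real.exp_pos _).le)

theorem hasSum_growthEval_mul {x y : ℕ → ℝ} {S R : GrowthSpace →L[ℝ] GrowthSpace}
    (hx : HasSum (fun a => x a • growthShift 1 ^ a) S)
    (hx' : Summable fun a => ‖x a • growthShift 1 ^ a‖)
    (hy : HasSum (fun a => y a • growthShift (-1) ^ a) R)
    (hy' : Summable fun a => ‖y a • growthShift (-1) ^ a‖) (h : GrowthSpace) (n : ℤ) :
    HasSum (fun z : ℕ × ℕ => x z.1 * y z.2 * growthEval (n + (z.1 - z.2)) h)
      (growthEval n ((S * R) h)) := by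
  have h2 := (hasSum_smul_pow_mul_smul_pow hx hx' hy hy').mapL
    ((growthEval n).comp (ContinuousLinearMap.apply ℝ GrowthSpace h))
  have e : ∀ z : ℕ × ℕ, ((growthEval n).comp (ContinuousLinearMap.apply ℝ GrowthSpace h))
      ((x z.1 * y z.2) • (growthShift 1 ^ z.1 * growthShift (-1) ^ z.2)) =
      x z.1 * y z.2 * growthEval (n + (z.1 - z.2)) h := by
    intro z
    rw [growthShift_pow, growthShift_pow, growthShift_mul, map_smul, smul_eq_mul,
      ContinuousLinearMap.comp_apply, ContinuousLinearMap.apply_apply, growthEval_growthShift]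
    ring_nf
  simp only [e] at h2
  exact h2

theorem hasSum_growthEval_growthHeat (t : ℝ) (h : GrowthSpace) (n : ℤ) :
    HasSum (fun z : ℕ × ℕ => poissonMass t z.1 * poissonMass t z.2 *
      growthEval (n + (z.1 - z.2)) h) (growthEval n (growthHeat t h)) := by
  rw [growthHeat_eq_mul]
  exact hasSum_growthEval_mul (hasSum_poissonMass_smul_pow t _)
    (summable_norm_poissonMass_smul_pow t _) (hasSum_poissonMass_smul_pow t _)
    (summable_norm_poissonMass_smul_pow t _) h n

theorem hasSum_growthEval_growthLaplacian_growthHeat {t : ℝ} (ht : t ≠ 0) (h : GrowthSpace)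
    (n : ℤ) :
    HasSum (fun z : ℕ × ℕ => poissonDiff t z.1 * poissonDiff t z.2 *
      growthEval (n + (z.1 - z.2)) h) (-growthEval n (growthLaplacian (growthHeat t h))) := by
  have h1 := hasSum_growthEval_mul (hasSum_poissonDiff_smul_pow ht (growthShift 1))
    (summable_norm_poissonDiff_smul_pow ht _) (hasSum_poissonDiff_smul_pow ht (growthShift (-1)))
    (summable_norm_poissonDiff_smul_pow ht _) h n
  rw [sub_one_mul_exp_mul_sub_one_mul_exp t (by rw [growthShift_mul]; exact growthShift_zero)
    (by rw [growthShift_mul]; exact growthShift_zero)] at h1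
  change HasSum _ (growthEval n ((-(growthLaplacian * growthHeat t)) h)) at h1
  rwa [neg_apply, map_neg] at h1

end GrowthSpace

/-! ### Identification with the Bessel-function kernel -/

section HeatSemigroup

/-- A pair of natural numbers is determined by its difference and its minimum. -/
def diffMinEquiv : ℤ × ℕ ≃ ℕ × ℕ where
  toFun z := (z.2 + z.1.toNat, z.2 + (-z.1).toNat)
  invFun z := ((z.1 : ℤ) - z.2, min z.1 z.2)
  left_inv z := by
    ext
    · simp
    · simp
      lia
  right_inv z := by
    ext <;> simp <;> lia

theorem poissonMass_mul_poissonMass_diffMinEquiv (t : ℝ) (j : ℤ) (m : ℕ) :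
    poissonMass t (diffMinEquiv (j, m)).1 * poissonMass t (diffMinEquiv (j, m)).2 =
      Real.exp (-2 * t) * ((2 * t / 2) ^ (2 * m + j.natAbs) /
        ((m ! : ℝ) * ((m + j.natAbs)! : ℝ))) := by
  simp only [diffMinEquiv, Equiv.coe_fn_mk, poissonMass]
  have he : Real.exp (-2 * t) = Real.exp (-t) * Real.exp (-t) := by
    rw [← Real.exp_add]
    ring_nf
  rw [he, mul_div_cancel_left₀ t two_ne_zero]
  rcases le_total 0 j with hj | hj
  · have h1 : j.toNat = j.natAbs := by lia
    have h2 : (-j).toNat = 0 := by lia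
    rw [h1, h2, add_zero]
    ring
  · have h1 : j.toNat = 0 := by lia
    have h2 : (-j).toNat = j.natAbs := by lia
    rw [h1, h2, add_zero]
    ring

theorem heatKernel_neg (t : ℝ) (n : ℤ) : heatKernel t (-n) = heatKernel t n := by
  simp [heatKernel, besselI]

/-- Group the pairs (a,b) of the double Poisson series by j = a-b: the fibre sum over min(a,b) is
the power series of the Bessel function. Absolute convergence of the kernel series comes along, and
evenness of the kernel turns j-n into n-j. -/
theorem hasSum_heatKernel_mul (t : ℝ) (h : GrowthSpace) (n : ℤ) :
    HasSum (fun j => heatKernel t (n - j) * growthEval j h) (growthEval n (growthHeat t h)) := by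
  have h1 := diffMinEquiv.hasSum_iff.2 (hasSum_growthEval_growthHeat t h n)
  have h2 := h1.prod_fiberwise (g := fun j => heatKernel t j * growthEval (n + j) h) fun j => by
    have h3 := (h1.summable.prod_factor j).hasSum
    have e : ∀ m : ℕ, ((fun z : ℕ × ℕ => poissonMass t z.1 * poissonMass t z.2 *
        growthEval (n + (z.1 - z.2)) h) ∘ diffMinEquiv) (j, m) =
        Real.exp (-2 * t) * ((2 * t / 2) ^ (2 * m + j.natAbs) /
        ((m ! : ℝ) * ((m + j.natAbs)! : ℝ))) * growthEval (n + j) h := by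
      intro m
      have h4 : ((diffMinEquiv (j, m)).1 : ℤ) - (diffMinEquiv (j, m)).2 = j :=
        congrArg Prod.fst (diffMinEquiv.left_inv (j, m))
      simp only [Function.comp_apply, poissonMass_mul_poissonMass_diffMinEquiv, h4]
    simp only [e] at h3 ⊢
    rwa [tsum_mul_right, tsum_mul_left] at h3
  have h5 := (Equiv.subRight n).hasSum_iff.2 h2
  have e : ∀ j : ℤ, ((fun j => heatKernel t j * growthEval (n + j) h) ∘ Equiv.subRight n) j =
      heatKernel t (n - j) * growthEval j h := by
    intro j
    simp only [Function.comp_apply, Equiv.subRight_apply, add_sub_cancel]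
    rw [← heatKernel_neg, neg_sub]
  exact (funext e) ▸ h5

theorem heatSemigroup_eq {f : ℤ → ℝ} {h : GrowthSpace} (hf : ∀ n, growthEval n h = f n) (t : ℝ)
    (n : ℤ) : heatSemigroup t f n = growthEval n (growthHeat t h) := by
  rw [← (hasSum_heatKernel_mul t h n).tsum_eq, heatSemigroup]
  simp only [hf]

/-- The operator exponential is differentiable in norm, so evaluating at n commutes with ∂_t and no
kernel series is differentiated term by term. -/
theorem iteratedDeriv_heatSemigroup {f : ℤ → ℝ} {h : GrowthSpace} (hf : ∀ n, growthEval n h = f n)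
    (n : ℤ) (l : ℕ) : iteratedDeriv l (fun s => heatSemigroup s f n) =
      fun t => growthEval n ((growthLaplacian ^ l) (growthHeat t h)) := by
  induction l with
  | zero =>
    funext t
    simp [heatSemigroup_eq hf]
  | succ l ih =>
    rw [iteratedDeriv_succ, ih]
    funext t
    have h1 := ((growthEval n).comp ((growthLaplacian ^ l).comp
      (ContinuousLinearMap.apply ℝ GrowthSpace h))).hasFDerivAt.comp_hasDerivAt t
      (hasDerivAt_growthHeat t)
    rw [pow_succ]
    exact h1.deriv

end HeatSemigroup

/-! ### Smoothing estimates on ℓ^p -/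

section HeatEstimates

/-- The `ℓ^p` norm of an element of the growth space. -/
noncomputable def growthNorm (p : ℝ≥0∞) (u : GrowthSpace) : ℝ≥0∞ :=
  eLpNorm (fun n => growthEval n u) p Measure.count

theorem eLpNorm_comp_add_count (p : ℝ≥0∞) (g : ℤ → ℝ) (d : ℤ) :
    eLpNorm (fun n => g (n + d)) p Measure.count = eLpNorm g p Measure.count :=
  eLpNorm_comp_measurePreserving .of_discrete (measurePreserving_add_right Measure.count d)

theorem enorm_le_tsum_of_hasSum {ι : Type*} {k F : ι → ℝ} {x : ℝ}
    (h : HasSum (fun i => k i * F i) x) : ‖x‖ₑ ≤ ∑' i, ‖k i‖ₑ * ‖F i‖ₑ := by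
  rw [← h.tsum_eq]
  simpa only [enorm_mul] using enorm_tsum_le_tsum_enorm (f := fun i => k i * F i)

theorem tsum_enorm_mul_prod (x y : ℕ → ℝ) :
    ∑' z : ℕ × ℕ, ‖x z.1 * y z.2‖ₑ = (∑' a, ‖x a‖ₑ) * ∑' b, ‖y b‖ₑ := by
  simp only [enorm_mul]
  rw [ENNReal.tsum_prod (f := fun a b => ‖x a‖ₑ * ‖y b‖ₑ)]
  simp only [ENNReal.tsum_mul_left, ENNReal.tsum_mul_right]

/-- Counting measure is translation invariant, so a superposition of translates costs only the ℓ¹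
norm of its coefficients, which here is a product. -/
theorem growthNorm_le_of_hasSum {p : ℝ≥0∞} (hp : 1 ≤ p) {x : ℕ → ℝ} {u : GrowthSpace}
    {g : ℤ → ℝ}
    (h : ∀ n, HasSum (fun z : ℕ × ℕ => x z.1 * x z.2 * growthEval (n + (z.1 - z.2)) u) (g n)) :
    eLpNorm g p Measure.count ≤ (∑' a, ‖x a‖ₑ) * (∑' a, ‖x a‖ₑ) * growthNorm p u := by
  have h1 := eLpNorm_le_tsum_mul (μ := Measure.count) hp (g := fun n => ‖g n‖ₑ)
    (k := fun z : ℕ × ℕ => ‖x z.1 * x z.2‖ₑ)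
    (F := fun z n => ‖growthEval (n + (z.1 - z.2)) u‖ₑ) (c := fun _ => growthNorm p u)
    (fun n => enorm_le_tsum_of_hasSum (h n)) fun z => by
      rw [eLpNorm_enorm]
      exact (eLpNorm_comp_add_count p (fun n => growthEval n u) _).le
  rwa [ENNReal.tsum_mul_right, tsum_enorm_mul_prod, eLpNorm_enorm] at h1

theorem tsum_enorm_poissonMass {t : ℝ} (ht : 0 ≤ t) : ∑' a, ‖poissonMass t a‖ₑ = 1 := by
  have h := hasSum_poissonMass t
  simp only [Real.enorm_of_nonneg (poissonMass_nonneg ht _)]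
  rw [← ENNReal.ofReal_tsum_of_nonneg (poissonMass_nonneg ht) h.summable, h.tsum_eq,
    ENNReal.ofReal_one]

theorem tsum_enorm_poissonDiff_le {t : ℝ} (ht : 0 < t) :
    ∑' a, ‖poissonDiff t a‖ₑ ≤ ENNReal.ofReal (1 / √t) := by
  simp only [Real.enorm_eq_ofReal_abs]
  rw [← ENNReal.ofReal_tsum_of_nonneg (fun _ => abs_nonneg _) (summable_abs_poissonDiff ht)]
  exact ENNReal.ofReal_le_ofReal (tsum_abs_poissonDiff_le ht)

theorem growthNorm_growthHeat_le {p : ℝ≥0∞} (hp : 1 ≤ p) {t : ℝ} (ht : 0 ≤ t) (u : GrowthSpace) :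
    growthNorm p (growthHeat t u) ≤ growthNorm p u := by
  have h := growthNorm_le_of_hasSum hp (hasSum_growthEval_growthHeat t u)
  rwa [tsum_enorm_poissonMass ht, one_mul, one_mul] at h

theorem growthNorm_growthLaplacian_growthHeat_le {p : ℝ≥0∞} (hp : 1 ≤ p) {t : ℝ} (ht : 0 < t)
    (u : GrowthSpace) :
    growthNorm p (growthLaplacian (growthHeat t u)) ≤ ENNReal.ofReal (1 / t) * growthNorm p u := by
  have h := growthNorm_le_of_hasSum hp (hasSum_growthEval_growthLaplacian_growthHeat ht.ne' u)
  have h1 : ENNReal.ofReal (1 / t) = ENNReal.ofReal (1 / √t) * ENNReal.ofReal (1 / √t) := by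
    rw [← ENNReal.ofReal_mul (by positivity), div_mul_div_comm, Real.mul_self_sqrt ht.le, one_mul]
  rw [h1]
  refine le_trans ?_ (h.trans ?_)
  · exact (eLpNorm_mono_enorm fun n => by simp)
  · have := tsum_enorm_poissonDiff_le ht
    gcongr

/-- Split the time in halves: one half pays for the new Laplacian, the other for the m earlier ones.
The factor 2^{m+1} comes from replacing t by t/2 in m+1 negative powers. -/
theorem exists_growthNorm_growthLaplacian_pow_growthHeat_le {p : ℝ≥0∞} (hp : 1 ≤ p) (m : ℕ) :
    ∃ C : ℝ, 0 ≤ C ∧ ∀ t : ℝ, 0 < t → ∀ u : GrowthSpace,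
      growthNorm p ((growthLaplacian ^ m) (growthHeat t u)) ≤
        ENNReal.ofReal (C * (1 / t) ^ m) * growthNorm p u := by
  induction m with
  | zero =>
    refine ⟨1, zero_le_one, fun t ht u => ?_⟩
    simpa using growthNorm_growthHeat_le hp ht.le u
  | succ m ih =>
    obtain ⟨C, hC, h⟩ := ih
    refine ⟨C * 2 ^ (m + 1), by positivity, fun t ht u => ?_⟩
    have h2 : 0 < t / 2 := half_pos ht
    have e : (growthLaplacian ^ (m + 1)) (growthHeat t u) =
        growthLaplacian (growthHeat (t / 2) ((growthLaplacian ^ m) (growthHeat (t / 2) u))) := by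
      have : growthLaplacian ^ (m + 1) * growthHeat t =
          growthLaplacian * growthHeat (t / 2) * (growthLaplacian ^ m * growthHeat (t / 2)) := by
        have hc : growthLaplacian ^ m * (growthHeat (t / 2) * growthHeat (t / 2)) =
            growthHeat (t / 2) * (growthLaplacian ^ m * growthHeat (t / 2)) := by
          have hc := (commute_growthLaplacian_growthHeat (t / 2)).pow_left m
          rw [← mul_assoc, hc.eq, mul_assoc, hc.eq]
        nth_rw 1 [← add_halves t]
        rw [growthHeat_add, pow_succ', mul_assoc, mul_assoc, hc]
      exact congrArg (fun S : GrowthSpace →L[ℝ] GrowthSpace => S u) this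
    rw [e]
    refine (growthNorm_growthLaplacian_growthHeat_le hp h2 _).trans ?_
    calc _ ≤ ENNReal.ofReal (1 / (t / 2)) *
          (ENNReal.ofReal (C * (1 / (t / 2)) ^ m) * growthNorm p u) := by
          gcongr
          exact h _ h2 u
      _ = _ := by
        rw [← mul_assoc, ← ENNReal.ofReal_mul (by positivity)]
        rw [show 1 / (t / 2) = 2 * (1 / t) by field_simp, mul_pow, pow_succ, pow_succ]
        congr 2
        ring

theorem continuous_growthEval_growthLaplacian_pow_growthHeat (n : ℤ) (l : ℕ) (u : GrowthSpace) :
    Continuous fun t => growthEval n ((growthLaplacian ^ l) (growthHeat t u)) :=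
  (growthEval n).continuous.comp ((growthLaplacian ^ l).continuous.comp
    (continuous_growthHeat.clm_apply continuous_const))

theorem measurable_growthNorm_growthLaplacian_pow_growthHeat (p : ℝ≥0∞) (l : ℕ)
    (u : GrowthSpace) :
    Measurable fun t => growthNorm p ((growthLaplacian ^ l) (growthHeat t u)) :=
  measurable_eLpNorm_count
    (fun n => (continuous_growthEval_growthLaplacian_pow_growthHeat n l u).measurable) p

end HeatEstimates

/-! ### The Bessel potential as a Bochner integral -/

section BesselPotential

/-- The subordination kernel `e^{-τ} τ^{β/2} / τ` of the Bessel potential. -/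
noncomputable def besselWeight (β τ : ℝ) : ℝ := Real.exp (-τ) * (τ ^ (β / 2) / τ)

theorem besselWeight_nonneg (β : ℝ) {τ : ℝ} (hτ : 0 < τ) : 0 ≤ besselWeight β τ := by
  unfold besselWeight
  positivity

theorem measurable_besselWeight (β : ℝ) : Measurable (besselWeight β) := by
  unfold besselWeight
  fun_prop

theorem integrableOn_besselWeight_mul_exp_half {β : ℝ} (hβ : 0 < β) :
    IntegrableOn (fun τ => besselWeight β τ * Real.exp (τ / 2)) (Ioi 0) := by
  have h := integrableOn_rpow_mul_exp_neg_mul_rpow (p := 1) (s := β / 2 - 1) (b := 1 / 2)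
    (by linarith) one_pos (by norm_num)
  refine h.congr_fun (fun τ hτ => ?_) measurableSet_Ioi
  have hτ' : (τ : ℝ) ≠ 0 := (mem_Ioi.1 hτ).ne'
  have e : Real.exp (-(1 / 2) * τ) = Real.exp (-τ) * Real.exp (τ / 2) := by
    rw [← Real.exp_add]
    ring_nf
  simp only [Real.rpow_one, Real.rpow_sub_one hτ', e, besselWeight]
  ring

theorem integrableOn_besselWeight_smul_growthHeat {β : ℝ} (hβ : 0 < β) (h : GrowthSpace) :
    IntegrableOn (fun τ => besselWeight β τ • growthHeat τ h) (Ioi 0) := by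
  refine Integrable.mono' ((integrableOn_besselWeight_mul_exp_half hβ).mul_const ‖h‖)
    ((measurable_besselWeight β).aestronglyMeasurable.smul
      (continuous_growthHeat.clm_apply continuous_const).aestronglyMeasurable) ?_
  filter_upwards [ae_restrict_mem measurableSet_Ioi] with τ hτ
  have hτ' : 0 < τ := hτ
  have h0 := besselWeight_nonneg β hτ'
  rw [norm_smul, Real.norm_of_nonneg h0, mul_assoc]
  gcongr
  exact (ContinuousLinearMap.le_opNorm _ _).trans (by gcongr; exact norm_growthHeat_le hτ'.le)

/-- The Bessel potential on the growth space. -/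
noncomputable def growthBessel (β : ℝ) (h : GrowthSpace) : GrowthSpace :=
  (1 / Real.Gamma (β / 2)) • ∫ τ in Ioi (0 : ℝ), besselWeight β τ • growthHeat τ h

theorem growthEval_growthBessel {β : ℝ} (hβ : 0 < β) (h : GrowthSpace)
    (L : GrowthSpace →L[ℝ] ℝ) :
    L (growthBessel β h) = 1 / Real.Gamma (β / 2) *
      ∫ τ in Ioi (0 : ℝ), besselWeight β τ * L (growthHeat τ h) := by
  rw [growthBessel, map_smul,
    ← L.integral_comp_comm (integrableOn_besselWeight_smul_growthHeat hβ h)]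
  simp

theorem besselIntegrand_eq (β : ℝ) {f : ℤ → ℝ} {h : GrowthSpace} (hf : ∀ n, growthEval n h = f n)
    (n : ℤ) : besselIntegrand β f n = fun τ => besselWeight β τ * growthEval n (growthHeat τ h) := by
  funext τ
  rw [besselIntegrand, heatSemigroup_eq hf, besselWeight]
  ring

theorem integrableOn_besselIntegrand {β : ℝ} (hβ : 0 < β) {f : ℤ → ℝ} {h : GrowthSpace}
    (hf : ∀ n, growthEval n h = f n) (n : ℤ) : IntegrableOn (besselIntegrand β f n) (Ioi 0) := by
  rw [besselIntegrand_eq β hf, IntegrableOn]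
  simpa using (growthEval n).integrable_comp (integrableOn_besselWeight_smul_growthHeat hβ h)

theorem besselPotential_eq {β : ℝ} (hβ : 0 < β) {f : ℤ → ℝ} {h : GrowthSpace}
    (hf : ∀ n, growthEval n h = f n) (n : ℤ) :
    growthEval n (growthBessel β h) = besselPotential β f n := by
  rw [growthEval_growthBessel hβ, besselPotential, besselIntegrand_eq β hf]

/-- The functional is arbitrary so that evaluation composed with Δ^l e^{tΔ} is allowed; this is how
the time derivatives pass under the Bessel integral. -/
theorem enorm_growthEval_growthBessel_le {β : ℝ} (hβ : 0 < β) (h : GrowthSpace)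
    (L : GrowthSpace →L[ℝ] ℝ) :
    ‖L (growthBessel β h)‖ₑ ≤ ENNReal.ofReal (1 / Real.Gamma (β / 2)) *
      ∫⁻ τ, ENNReal.ofReal (Real.exp (-τ) * τ ^ (β / 2)) * ‖L (growthHeat τ h)‖ₑ ∂multMeasure := by
  have hc : Continuous fun τ => L (growthHeat τ h) :=
    L.continuous.comp (continuous_growthHeat.clm_apply continuous_const)
  have hm : Measurable fun τ =>
      ENNReal.ofReal (Real.exp (-τ) * τ ^ (β / 2)) * ‖L (growthHeat τ h)‖ₑ :=
    Measurable.mul (by fun_prop) hc.measurable.enorm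
  rw [growthEval_growthBessel hβ, enorm_mul, Real.enorm_of_nonneg
    (one_div_nonneg.2 (Real.Gamma_pos_of_pos (half_pos hβ)).le),
    lintegral_multMeasure hm]
  gcongr
  refine (enorm_integral_le_lintegral_enorm _).trans
    (setLIntegral_mono' measurableSet_Ioi fun τ hτ => ?_)
  have hτ' : 0 < τ := hτ
  rw [enorm_mul, Real.enorm_of_nonneg (besselWeight_nonneg β hτ'), ← mul_assoc,
    ← ENNReal.ofReal_mul (by positivity)]
  gcongr
  rw [besselWeight]
  apply le_of_eq
  ring

end BesselPotential

/-! ### The weighted ℓ^q condition -/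

section WeightCondition

theorem exists_rpow_le_growthWeight (s : ℝ) :
    ∃ C : ℝ, 0 ≤ C ∧ ∀ n : ℤ, (1 + |(n : ℝ)|) ^ s ≤ C * growthWeight n := by
  set b := Real.log (5 / 4) with hb
  have hb0 : 0 < b := Real.log_pos (by norm_num)
  set N := ⌈s⌉₊ with hN
  -- From x^N/N! ≤ e^x at x = (|n|+1) log(5/4); the last factor 5/4 accounts for the +1.
  refine ⟨(N ! : ℝ) / b ^ N * (5 / 4), by positivity, fun n => ?_⟩
  have hx : |(n : ℝ)| = (n.natAbs : ℝ) := by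
    rw [Nat.cast_natAbs, Int.cast_abs]
  set m := n.natAbs
  rw [hx, growthWeight]
  have h1 : (1 + (m : ℝ)) ^ s ≤ (1 + (m : ℝ)) ^ N := by
    rw [← Real.rpow_natCast]
    exact Real.rpow_le_rpow_of_exponent_le (by simp) (Nat.le_ceil s)
  have h2 := Real.pow_div_factorial_le_exp (x := b * (m + 1 : ℕ)) (by positivity) N
  have h3 : Real.exp (b * (m + 1 : ℕ)) = (5 / 4) ^ (m + 1) := by
    rw [mul_comm, Real.exp_nat_mul, hb, Real.exp_log (by norm_num)]
  rw [h3, div_le_iff₀ (by positivity), mul_pow, mul_comm, ← le_div_iff₀ (by positivity)] at h2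
  push_cast at h2
  calc (1 + (m : ℝ)) ^ s ≤ ((m : ℝ) + 1) ^ N := by rwa [add_comm (m : ℝ)]
    _ ≤ _ := h2
    _ = _ := by
      rw [pow_succ]
      ring

theorem one_add_rpow_le {α x : ℝ} (hα : 0 ≤ α) (hx : 0 ≤ x) : 1 + x ^ α ≤ 2 * (1 + x) ^ α := by
  have h1 : (1 : ℝ) ≤ (1 + x) ^ α := Real.one_le_rpow (by linarith) hα
  have h2 : x ^ α ≤ (1 + x) ^ α := Real.rpow_le_rpow hx (by linarith) hα
  linarith

theorem rpow_one_add_le {α x : ℝ} (hα : 0 ≤ α) (hx : 0 ≤ x) :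
    (1 + x) ^ α ≤ 2 ^ α * (1 + x ^ α) := by
  have h0 := Real.rpow_nonneg hx α
  have h2 : (0 : ℝ) ≤ 2 ^ α := by positivity
  rcases le_total x 1 with h | h
  · calc (1 + x) ^ α ≤ 2 ^ α := Real.rpow_le_rpow (by linarith) (by linarith) hα
      _ ≤ 2 ^ α * (1 + x ^ α) := le_mul_of_one_le_right h2 (by linarith)
  · calc (1 + x) ^ α ≤ (2 * x) ^ α := Real.rpow_le_rpow (by linarith) (by linarith) hα
      _ = 2 ^ α * x ^ α := Real.mul_rpow (by norm_num) hx
      _ ≤ 2 ^ α * (1 + x ^ α) := by gcongr; linarith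

theorem one_add_abs_add_rpow_le {α : ℝ} (hα : 0 ≤ α) (x y : ℝ) :
    1 + |x + y| ^ α ≤ (1 + 2 ^ α) * ((1 + |x| ^ α) * (1 + |y|) ^ α) := by
  have hx := abs_nonneg x
  have hy := abs_nonneg y
  have h1 : |x + y| ^ α ≤ (1 + |x|) ^ α * (1 + |y|) ^ α := by
    rw [← Real.mul_rpow (by positivity) (by positivity)]
    refine Real.rpow_le_rpow (abs_nonneg _) ?_ hα
    nlinarith [abs_add_le x y, mul_nonneg hx hy]
  have h2 := rpow_one_add_le hα hx
  have h3 : (1 : ℝ) ≤ (1 + |y|) ^ α := Real.one_le_rpow (by linarith) hα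
  have h4 : (0 : ℝ) ≤ |x| ^ α := by positivity
  have h5 : (1 + |x|) ^ α * (1 + |y|) ^ α ≤ 2 ^ α * (1 + |x| ^ α) * (1 + |y|) ^ α := by gcongr
  nlinarith [mul_nonneg h4 (zero_le_one.trans h3)]

/-- The weighted function `f / (1 + |·|^α)`. -/
noncomputable def weighted (α : ℝ) (f : ℤ → ℝ) (n : ℤ) : ℝ := f n / (1 + |(n : ℝ)| ^ α)

theorem exists_eLpNorm_weighted_comp_add_le {α : ℝ} (hα : 0 ≤ α) {q : ℝ≥0∞} (hq : 1 ≤ q) :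
    ∃ C : ℝ, 0 ≤ C ∧ ∀ (f : ℤ → ℝ) (d : ℤ),
      eLpNorm (weighted α fun n => f (n + d)) q weightMeasure ≤
        ENNReal.ofReal (C * growthWeight d) * eLpNorm (weighted α f) q weightMeasure := by
  -- The exponent is α for translating the weight 1+|n|^α, plus 1 for translating μ.
  obtain ⟨C, hC, h⟩ := exists_rpow_le_growthWeight (α + 1)
  refine ⟨(1 + 2 ^ α) * C, by positivity, fun f d => ?_⟩
  have h1 : eLpNorm (weighted α fun n => f (n + d)) q weightMeasure ≤
      ENNReal.ofReal ((1 + 2 ^ α) * (1 + |(d : ℝ)|) ^ α) *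
        eLpNorm (fun n => weighted α f (n + d)) q weightMeasure := by
    refine eLpNorm_le_mul_eLpNorm_of_ae_le_mul (.of_forall fun n => ?_) q
    have hn : 0 < 1 + |(n : ℝ)| ^ α := by positivity
    have hnd : 0 < 1 + |((n + d : ℤ) : ℝ)| ^ α := by positivity
    rw [weighted, weighted, norm_div, norm_div, Real.norm_of_nonneg hn.le,
      Real.norm_of_nonneg hnd.le, div_le_iff₀ hn]
    have h2 := one_add_abs_add_rpow_le hα (n : ℝ) d
    rw [← mul_div_assoc, div_mul_eq_mul_div, le_div_iff₀ hnd]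
    push_cast
    refine (mul_le_mul_of_nonneg_left h2 (norm_nonneg (f (n + d)))).trans (le_of_eq ?_)
    ring
  refine h1.trans ?_
  calc _ ≤ ENNReal.ofReal ((1 + 2 ^ α) * (1 + |(d : ℝ)|) ^ α) *
        (ENNReal.ofReal (1 + |(d : ℝ)|) * eLpNorm (weighted α f) q weightMeasure) := by
        gcongr
        exact eLpNorm_comp_add_weightMeasure_le hq _ d
    _ ≤ _ := by
      rw [← mul_assoc, ← ENNReal.ofReal_mul (by positivity)]
      refine mul_le_mul_left (ENNReal.ofReal_le_ofReal ?_) _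
      have h2 := h d
      rw [Real.rpow_add_one (by positivity)] at h2
      rw [mul_assoc, mul_assoc]
      exact mul_le_mul_of_nonneg_left h2 (by positivity)

/-- The atom bound gives growth of order (1+|n|)^{α+1}, which the exponential weight dominates; this
brings `f` into the Banach space. -/
theorem exists_growthEval_eq_of_memLp {α : ℝ} (hα : 0 ≤ α) {q : ℝ≥0∞} (hq : 1 ≤ q) {f : ℤ → ℝ}
    (hf : MemLp (weighted α f) q weightMeasure) :
    ∃ h : GrowthSpace, ∀ n, growthEval n h = f n := by
  obtain ⟨C, hC, h⟩ := exists_rpow_le_growthWeight (α + 1)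
  set M := (eLpNorm (weighted α f) q weightMeasure).toReal with hM
  refine exists_growthEval_eq (C := 2 * M * C) fun n => ?_
  have hn : 0 < 1 + |(n : ℝ)| ^ α := by positivity
  have h1 := enorm_le_eLpNorm_weightMeasure hq (weighted α f) n
  rw [← ENNReal.ofReal_toReal hf.eLpNorm_ne_top, ← ENNReal.ofReal_mul (by positivity),
    Real.enorm_eq_ofReal_abs, ENNReal.ofReal_le_ofReal_iff (by positivity), weighted, abs_div,
    abs_of_pos hn, div_le_iff₀ hn, ← hM] at h1
  have h2 := one_add_rpow_le hα (abs_nonneg (n : ℝ))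
  have h3 := h n
  rw [Real.rpow_add_one (by positivity)] at h3
  calc |f n| ≤ (1 + |(n : ℝ)|) * M * (1 + |(n : ℝ)| ^ α) := h1
    _ ≤ (1 + |(n : ℝ)|) * M * (2 * (1 + |(n : ℝ)|) ^ α) := by gcongr
    _ = 2 * M * ((1 + |(n : ℝ)|) ^ α * (1 + |(n : ℝ)|)) := by ring
    _ ≤ 2 * M * (C * growthWeight n) := by gcongr
    _ = _ := by ring

theorem growthWeight_sub_le (a b : ℕ) :
    growthWeight ((a : ℤ) - b) ≤ (5 / 4) ^ a * (5 / 4) ^ b := by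
  rw [growthWeight, ← pow_add]
  exact pow_le_pow_right₀ (by norm_num) (by lia)

theorem tsum_ofReal_poissonMass_mul_pow {t : ℝ} (ht : 0 ≤ t) :
    ∑' a, ENNReal.ofReal (poissonMass t a * (5 / 4) ^ a) = ENNReal.ofReal (Real.exp (t / 4)) := by
  have h := hasSum_poissonMass_mul_pow t (5 / 4)
  rw [← ENNReal.ofReal_tsum_of_nonneg
    (fun a => mul_nonneg (poissonMass_nonneg ht a) (by positivity)) h.summable, h.tsum_eq]
  ring_nf

theorem weighted_apply_enorm (α : ℝ) (f : ℤ → ℝ) (n : ℤ) :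
    ‖weighted α f n‖ₑ = ‖f n‖ₑ * ‖(1 + |(n : ℝ)| ^ α)⁻¹‖ₑ := by
  rw [weighted, div_eq_mul_inv, enorm_mul]

/-- In the double Poisson series, the translate by a-b costs at most a multiple of (5/4)^{a+b}; the
Poisson generating function at 5/4 then gives e^{t/4} twice. -/
theorem exists_eLpNorm_weighted_growthHeat_le {α : ℝ} (hα : 0 ≤ α) {q : ℝ≥0∞} (hq : 1 ≤ q) :
    ∃ C : ℝ, 0 ≤ C ∧ ∀ (u : GrowthSpace) (t : ℝ), 0 ≤ t →
      eLpNorm (weighted α fun n => growthEval n (growthHeat t u)) q weightMeasure ≤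
        ENNReal.ofReal (C * Real.exp (t / 2)) *
          eLpNorm (weighted α fun n => growthEval n u) q weightMeasure := by
  obtain ⟨C, hC, h⟩ := exists_eLpNorm_weighted_comp_add_le hα hq
  refine ⟨C, hC, fun u t ht => ?_⟩
  set M := eLpNorm (weighted α fun n => growthEval n u) q weightMeasure with hM
  have h1 := eLpNorm_le_tsum_mul (μ := weightMeasure) hq
    (g := fun n => ‖weighted α (fun n => growthEval n (growthHeat t u)) n‖ₑ)
    (k := fun z : ℕ × ℕ => ‖poissonMass t z.1 * poissonMass t z.2‖ₑ)
    (F := fun z n => ‖weighted α (fun n => growthEval (n + (z.1 - z.2)) u) n‖ₑ)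
    (c := fun z => ENNReal.ofReal (C * ((5 / 4) ^ z.1 * (5 / 4) ^ z.2)) * M)
    (fun n => ?_) (fun z => ?_)
  · rw [eLpNorm_enorm] at h1
    refine h1.trans (le_of_eq ?_)
    have e : ∀ z : ℕ × ℕ, ‖poissonMass t z.1 * poissonMass t z.2‖ₑ *
        (ENNReal.ofReal (C * ((5 / 4) ^ z.1 * (5 / 4) ^ z.2)) * M) =
        ENNReal.ofReal (poissonMass t z.1 * (5 / 4) ^ z.1) *
          ENNReal.ofReal (poissonMass t z.2 * (5 / 4) ^ z.2) * (ENNReal.ofReal C * M) := by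
      intro z
      have ha := poissonMass_nonneg ht z.1
      have hb := poissonMass_nonneg ht z.2
      rw [Real.enorm_of_nonneg (by positivity), ← mul_assoc, ← mul_assoc _ _ M,
        ← ENNReal.ofReal_mul (by positivity), ← ENNReal.ofReal_mul (by positivity),
        ← ENNReal.ofReal_mul (by positivity)]
      ring_nf
    simp only [e]
    rw [ENNReal.tsum_mul_right, ENNReal.tsum_prod (f := fun a b =>
      ENNReal.ofReal (poissonMass t a * (5 / 4) ^ a) *
        ENNReal.ofReal (poissonMass t b * (5 / 4) ^ b))]
    simp only [ENNReal.tsum_mul_left, ENNReal.tsum_mul_right, tsum_ofReal_poissonMass_mul_pow ht]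
    rw [← mul_assoc, ← ENNReal.ofReal_mul (by positivity), ← Real.exp_add,
      ← ENNReal.ofReal_mul (by positivity)]
    ring_nf
  · simp only [weighted_apply_enorm, ← mul_assoc]
    rw [ENNReal.tsum_mul_right]
    gcongr
    exact enorm_le_tsum_of_hasSum (hasSum_growthEval_growthHeat t u n)
  · rw [eLpNorm_enorm]
    refine (h (fun n => growthEval n u) (z.1 - z.2)).trans ?_
    gcongr
    exact growthWeight_sub_le _ _

/-- Minkowski in τ, with the growth e^{τ/2} absorbed by e^{-τ}. The exponent α is kept; passing to a
larger one only enlarges the denominator, up to a constant. -/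
theorem memLp_weighted_growthBessel {α β : ℝ} (hα : 0 ≤ α) (hβ : 0 < β) {q : ℝ≥0∞} (hq : 1 ≤ q)
    {h : GrowthSpace} (hf : MemLp (weighted α fun n => growthEval n h) q weightMeasure) :
    MemLp (weighted α fun n => growthEval n (growthBessel β h)) q weightMeasure := by
  refine ⟨.of_discrete, ?_⟩
  obtain ⟨C, hC, hH⟩ := exists_eLpNorm_weighted_growthHeat_le hα hq
  set M := eLpNorm (weighted α fun n => growthEval n h) q weightMeasure with hM
  set Γc := ENNReal.ofReal (1 / Real.Gamma (β / 2)) with hΓc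
  have hcont : ∀ n, Continuous fun τ => growthEval n (growthHeat τ h) := fun n =>
    (growthEval n).continuous.comp (continuous_growthHeat.clm_apply continuous_const)
  have hGm : ∀ n, Measurable fun τ =>
      ENNReal.ofReal (Real.exp (-τ) * τ ^ (β / 2)) * ‖growthEval n (growthHeat τ h)‖ₑ := fun n =>
    Measurable.mul (by fun_prop) (hcont n).measurable.enorm
  set F : ℤ → ℝ → ℝ≥0∞ := fun n τ => Γc * (ENNReal.ofReal (Real.exp (-τ) * τ ^ (β / 2)) *
    ‖weighted α (fun n => growthEval n (growthHeat τ h)) n‖ₑ) with hF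
  set c : ℝ → ℝ≥0∞ := fun τ => Γc * (ENNReal.ofReal (Real.exp (-τ) * τ ^ (β / 2)) *
    (ENNReal.ofReal (C * Real.exp (τ / 2)) * M)) with hc
  have hFm : Measurable (Function.uncurry F) := by
    refine measurable_from_prod_countable_right fun n => ?_
    simp only [Function.uncurry, hF, weighted_apply_enorm]
    exact ((Measurable.mul (by fun_prop) ((hcont n).measurable.enorm.mul_const _))).const_mul _
  have hcm : Measurable c := by fun_prop
  have h1 := eLpNorm_lintegral_le (μ := weightMeasure) (ν := multMeasure) hFm hcm hq (by
    filter_upwards [ae_multMeasure_pos] with τ hτ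
    refine (eLpNorm_le_mul_eLpNorm_of_ae_le_mul''
      (c := Γc * ENNReal.ofReal (Real.exp (-τ) * τ ^ (β / 2)))
      (g := weighted α (fun n => growthEval n (growthHeat τ h))) q .of_discrete
      (.of_forall fun n => by simp [hF, mul_assoc])).trans ?_
    simp only [hc, mul_assoc]
    gcongr
    exact hH h τ hτ.le)
  refine lt_of_le_of_lt (le_trans (eLpNorm_mono_enorm fun n => ?_) h1) ?_
  · rw [enorm_eq_self, weighted_apply_enorm]
    have e : ∀ τ, F n τ = Γc * (ENNReal.ofReal (Real.exp (-τ) * τ ^ (β / 2)) *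
        ‖growthEval n (growthHeat τ h)‖ₑ) * ‖(1 + |(n : ℝ)| ^ α)⁻¹‖ₑ := fun τ => by
      simp only [hF, weighted_apply_enorm, mul_assoc]
    simp only [e]
    rw [lintegral_mul_const _ ((hGm n).const_mul Γc), lintegral_const_mul _ (hGm n)]
    gcongr
    exact enorm_growthEval_growthBessel_le hβ h _
  · rw [lintegral_multMeasure hcm]
    have h2 := ((integrableOn_besselWeight_mul_exp_half hβ).const_mul C).lintegral_lt_top
    have e : ∀ τ ∈ Ioi (0 : ℝ), ENNReal.ofReal (1 / τ) * c τ =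
        Γc * M * ENNReal.ofReal (C * (besselWeight β τ * Real.exp (τ / 2))) := by
      intro τ hτ
      have hτ' : 0 < τ := hτ
      have e1 : ENNReal.ofReal (C * (besselWeight β τ * Real.exp (τ / 2))) =
          ENNReal.ofReal (1 / τ) * ENNReal.ofReal (Real.exp (-τ) * τ ^ (β / 2)) *
            ENNReal.ofReal (C * Real.exp (τ / 2)) := by
        rw [← ENNReal.ofReal_mul (by positivity), ← ENNReal.ofReal_mul (by positivity),
          besselWeight]
        ring_nf
      rw [e1, hc]
      ring
    rw [setLIntegral_congr_fun measurableSet_Ioi e, lintegral_const_mul' _ _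
      (ENNReal.mul_ne_top ENNReal.ofReal_ne_top hf.eLpNorm_ne_top)]
    exact ENNReal.mul_lt_top (ENNReal.mul_lt_top ENNReal.ofReal_lt_top hf.eLpNorm_lt_top) h2

theorem memLp_weighted_of_le {α γ : ℝ} (hα : 0 ≤ α) (hαγ : α ≤ γ) {q : ℝ≥0∞} {f : ℤ → ℝ}
    (hf : MemLp (weighted α f) q weightMeasure) : MemLp (weighted γ f) q weightMeasure := by
  refine MemLp.of_le_mul (c := 2) hf .of_discrete (.of_forall fun n => ?_)
  have hn : 0 < 1 + |(n : ℝ)| ^ α := by positivity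
  have hn' : 0 < 1 + |(n : ℝ)| ^ γ := by positivity
  have key : 1 + |(n : ℝ)| ^ α ≤ 2 * (1 + |(n : ℝ)| ^ γ) := by
    have h0 : (0 : ℝ) ≤ |(n : ℝ)| ^ γ := by positivity
    rcases le_total |(n : ℝ)| 1 with h | h
    · have := Real.rpow_le_one (abs_nonneg _) h hα
      linarith
    · have := Real.rpow_le_rpow_of_exponent_le h hαγ
      linarith
  rw [weighted, weighted, norm_div, norm_div, Real.norm_of_nonneg hn.le,
    Real.norm_of_nonneg hn'.le, ← mul_div_assoc, div_le_div_iff₀ hn' hn]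
  calc ‖f n‖ * (1 + |(n : ℝ)| ^ α) ≤ ‖f n‖ * (2 * (1 + |(n : ℝ)| ^ γ)) := by gcongr
    _ = _ := by ring

end WeightCondition

/-! ### The Besov seminorm -/

section BesovCondition

/-- The function `t ↦ t^a ‖∂_t^l e^{tΔ} u‖_{ℓ^p}`. -/
noncomputable def heatProfile (p : ℝ≥0∞) (a : ℝ) (l : ℕ) (u : GrowthSpace) (t : ℝ) : ℝ≥0∞ :=
  ENNReal.ofReal (t ^ a) * growthNorm p ((growthLaplacian ^ l) (growthHeat t u))

theorem measurable_heatProfile (p : ℝ≥0∞) (a : ℝ) (l : ℕ) (u : GrowthSpace) :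
    Measurable (heatProfile p a l u) :=
  Measurable.mul (by fun_prop) (measurable_growthNorm_growthLaplacian_pow_growthHeat p l u)

theorem eLpNorm_rpow_mul_iteratedDeriv {f : ℤ → ℝ} {h : GrowthSpace}
    (hf : ∀ n, growthEval n h = f n) (p : ℝ≥0∞) (a : ℝ) (l : ℕ) {t : ℝ} (ht : 0 < t) :
    eLpNorm (fun n => t ^ a * iteratedDeriv l (fun s => heatSemigroup s f n) t) p Measure.count =
      heatProfile p a l h t := by
  simp only [iteratedDeriv_heatSemigroup hf]
  have := eLpNorm_const_smul (t ^ a)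
    (fun n => growthEval n ((growthLaplacian ^ l) (growthHeat t h))) p Measure.count
  rw [heatProfile, growthNorm, ← Real.enorm_of_nonneg (by positivity), ← this]
  rfl

theorem mixedNorm_eq {f : ℤ → ℝ} {h : GrowthSpace} (hf : ∀ n, growthEval n h = f n)
    (p q : ℝ≥0∞) (a : ℝ) (l : ℕ) :
    mixedNorm p q (fun t n => t ^ a * iteratedDeriv l (fun s => heatSemigroup s f n) t) =
      eLpNorm (heatProfile p a l h) q multMeasure := by
  refine eLpNorm_congr_ae ?_
  filter_upwards [ae_multMeasure_pos] with t ht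
  exact eLpNorm_rpow_mul_iteratedDeriv hf p a l ht

theorem eLpNorm_comp_mul_left_multMeasure {c : ℝ} (hc : 0 < c) {ψ : ℝ → ℝ≥0∞}
    (hψ : Measurable ψ) (q : ℝ≥0∞) :
    eLpNorm (fun t => ψ (c * t)) q multMeasure = eLpNorm ψ q multMeasure :=
  eLpNorm_comp_measurePreserving hψ.aestronglyMeasurable
    (measurePreserving_mul_left_multMeasure hc)

/-- The m extra derivatives act on half of the time and cost t^{-m}, which the additional power t^m
cancels. The profile on the right is taken at t/2, harmless for a dilation-invariant norm. -/
theorem exists_heatProfile_add_le {p : ℝ≥0∞} (hp : 1 ≤ p) (a : ℝ) (k m : ℕ) :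
    ∃ C : ℝ, 0 ≤ C ∧ ∀ (u : GrowthSpace) (t : ℝ), 0 < t →
      heatProfile p (a + m) (k + m) u t ≤ ENNReal.ofReal C * heatProfile p a k u (1 / 2 * t) := by
  obtain ⟨C, hC, H⟩ := exists_growthNorm_growthLaplacian_pow_growthHeat_le hp m
  refine ⟨2 ^ m * 2 ^ a * C, by positivity, fun u t ht => ?_⟩
  have h2 : 0 < 1 / 2 * t := by positivity
  have e : (growthLaplacian ^ (k + m)) (growthHeat t u) =
      (growthLaplacian ^ m) (growthHeat (1 / 2 * t)
        ((growthLaplacian ^ k) (growthHeat (1 / 2 * t) u))) := by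
    have hc : Commute (growthLaplacian ^ k) (growthHeat (1 / 2 * t)) :=
      (commute_growthLaplacian_growthHeat (1 / 2 * t)).pow_left k
    have : growthLaplacian ^ (k + m) * growthHeat t =
        growthLaplacian ^ m * growthHeat (1 / 2 * t) *
          (growthLaplacian ^ k * growthHeat (1 / 2 * t)) := by
      rw [hc.eq, show growthHeat t = growthHeat (1 / 2 * t) * growthHeat (1 / 2 * t) by
        rw [← growthHeat_add]; ring_nf, add_comm k m, pow_add, mul_assoc, mul_assoc,
        ← mul_assoc _ _ (growthHeat (1 / 2 * t)), hc.eq, mul_assoc, hc.eq]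
    exact congrArg (fun S : GrowthSpace →L[ℝ] GrowthSpace => S u) this
  rw [heatProfile, heatProfile, e]
  calc _ ≤ ENNReal.ofReal (t ^ (a + m)) * (ENNReal.ofReal (C * (1 / (1 / 2 * t)) ^ m) *
        growthNorm p ((growthLaplacian ^ k) (growthHeat (1 / 2 * t) u))) := by
        gcongr
        exact H _ h2 _
    _ = _ := by
      rw [← mul_assoc, ← mul_assoc, ← ENNReal.ofReal_mul (by positivity),
        ← ENNReal.ofReal_mul (by positivity), Real.mul_rpow (by norm_num) ht.le,
        Real.rpow_add ht, Real.rpow_natCast, one_div_mul_eq_div, one_div_div, div_pow,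
        Real.div_rpow zero_le_one zero_le_two, Real.one_rpow]
      congr 2
      field_simp

theorem eLpNorm_heatProfile_add_lt_top {p : ℝ≥0∞} (hp : 1 ≤ p) {q : ℝ≥0∞} {a : ℝ} {k : ℕ}
    {u : GrowthSpace} (h : eLpNorm (heatProfile p a k u) q multMeasure < ∞) (m : ℕ) :
    eLpNorm (heatProfile p (a + m) (k + m) u) q multMeasure < ∞ := by
  obtain ⟨C, -, H⟩ := exists_heatProfile_add_le hp a k m
  have hm := measurable_heatProfile p a k u
  have h1 : eLpNorm (heatProfile p (a + m) (k + m) u) q multMeasure ≤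
      ENNReal.ofReal C * eLpNorm (fun t => heatProfile p a k u (1 / 2 * t)) q multMeasure := by
    refine eLpNorm_le_mul_eLpNorm_of_ae_le_mul'' q
      (hm.comp (measurable_const_mul _)).aestronglyMeasurable ?_
    filter_upwards [ae_multMeasure_pos] with t ht
    exact H u t ht
  rw [eLpNorm_comp_mul_left_multMeasure (by norm_num) hm] at h1
  exact h1.trans_lt (ENNReal.mul_lt_top ENNReal.ofReal_lt_top h)

/-- With τ = tr, the powers recombine as t^{a-β/2}(tr)^{β/2} = r^{β/2}(1+r)^{-a}((1+r)t)^a, and the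
last factor belongs to the profile at time t+τ. -/
theorem heatProfile_growthBessel_le {p : ℝ≥0∞} (hp : 1 ≤ p) {β : ℝ} (hβ : 0 < β) (a : ℝ) (l : ℕ)
    (h : GrowthSpace) {t : ℝ} (ht : 0 < t) :
    heatProfile p (a - β / 2) l (growthBessel β h) t ≤
      ENNReal.ofReal (1 / Real.Gamma (β / 2)) * ∫⁻ r,
        ENNReal.ofReal (r ^ (β / 2) * (1 + r) ^ (-a)) * heatProfile p a l h ((1 + r) * t)
          ∂multMeasure := by
  set Γc := ENNReal.ofReal (1 / Real.Gamma (β / 2)) with hΓc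
  set E : ℤ → ℝ → ℝ≥0∞ := fun n s =>
    ‖growthEval n ((growthLaplacian ^ l) (growthHeat s h))‖ₑ with hE
  have hEm : ∀ n, Measurable (E n) := fun n =>
    (continuous_growthEval_growthLaplacian_pow_growthHeat n l h).measurable.enorm
  have hpt : ∀ n, ‖growthEval n ((growthLaplacian ^ l) (growthHeat t (growthBessel β h)))‖ₑ ≤
      Γc * ∫⁻ r, ENNReal.ofReal ((t * r) ^ (β / 2)) * E n (t + t * r) ∂multMeasure := by
    intro n
    have h1 := enorm_growthEval_growthBessel_le hβ h
      ((growthEval n).comp ((growthLaplacian ^ l).comp (growthHeat t)))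
    refine h1.trans ?_
    rw [lintegral_multMeasure_comp_mul_left ht
      (ψ := fun τ => ENNReal.ofReal (τ ^ (β / 2)) * E n (t + τ))
      (Measurable.mul (by fun_prop) ((hEm n).comp (measurable_const_add t)))]
    rw [← hΓc]
    gcongr Γc * ?_
    refine lintegral_mono_ae ?_
    filter_upwards [ae_multMeasure_pos] with τ hτ
    simp only [hE, growthHeat_add]
    gcongr ENNReal.ofReal ?_ * ?_
    -- The exponential e^{-τ} is only bounded by 1 here: its decay is not needed for the seminorm.
    · exact mul_le_of_le_one_left (by positivity) (Real.exp_le_one_iff.2 (by linarith))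
    · exact le_rfl
  set F : ℤ → ℝ → ℝ≥0∞ := fun n r => ENNReal.ofReal (t ^ (a - β / 2)) *
    (Γc * (ENNReal.ofReal ((t * r) ^ (β / 2)) * E n (t + t * r))) with hF
  have hFn : ∀ n, Measurable (F n) := fun n =>
    ((Measurable.mul (by fun_prop) ((hEm n).comp (by fun_prop))).const_mul _).const_mul _
  have hFm : Measurable (Function.uncurry F) := measurable_from_prod_countable_right hFn
  set c : ℝ → ℝ≥0∞ := fun r => Γc * (ENNReal.ofReal (r ^ (β / 2) * (1 + r) ^ (-a)) *
    heatProfile p a l h ((1 + r) * t)) with hc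
  have hcm' : Measurable fun r => ENNReal.ofReal (r ^ (β / 2) * (1 + r) ^ (-a)) *
      heatProfile p a l h ((1 + r) * t) :=
    Measurable.mul (by fun_prop) ((measurable_heatProfile p a l h).comp (by fun_prop))
  have hcm : Measurable c := hcm'.const_mul _
  rw [← lintegral_const_mul _ hcm']
  refine le_trans ?_ (eLpNorm_lintegral_le (μ := Measure.count) (ν := multMeasure) hFm hcm hp ?_)
  · have h1 := eLpNorm_const_smul (t ^ (a - β / 2)) (fun n => growthEval n ((growthLaplacian ^ l)
      (growthHeat t (growthBessel β h)))) p Measure.count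
    rw [Real.enorm_of_nonneg (by positivity)] at h1
    rw [heatProfile, growthNorm, ← h1]
    refine eLpNorm_mono_enorm fun n => ?_
    rw [enorm_eq_self, lintegral_const_mul' _ _ ENNReal.ofReal_ne_top,
      lintegral_const_mul' _ _ ENNReal.ofReal_ne_top, Pi.smul_apply, smul_eq_mul, enorm_mul,
      Real.enorm_of_nonneg (by positivity)]
    gcongr
    exact hpt n
  · filter_upwards [ae_multMeasure_pos] with r hr
    have h1 : eLpNorm (fun n => F n r) p Measure.count ≤
        ENNReal.ofReal (t ^ (a - β / 2)) * (Γc * ENNReal.ofReal ((t * r) ^ (β / 2))) *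
          growthNorm p ((growthLaplacian ^ l) (growthHeat (t + t * r) h)) :=
      eLpNorm_le_mul_eLpNorm_of_ae_le_mul'' p .of_discrete
        (.of_forall fun n => by simp [hF, hE, mul_assoc])
    refine h1.trans (le_of_eq ?_)
    have h2 : (1 + r) * t = t + t * r := by ring
    have h3 : t ^ (a - β / 2) * (t * r) ^ (β / 2) =
        r ^ (β / 2) * (1 + r) ^ (-a) * ((1 + r) * t) ^ a := by
      rw [Real.mul_rpow ht.le hr.le, Real.mul_rpow (by positivity) ht.le, Real.rpow_sub ht,
        Real.rpow_neg (by positivity)]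
      have := (Real.rpow_pos_of_pos ht (β / 2)).ne'
      have := (Real.rpow_pos_of_pos (by linarith : 0 < 1 + r) a).ne'
      field_simp
    have h4 := congrArg ENNReal.ofReal h3
    rw [ENNReal.ofReal_mul (by positivity), ENNReal.ofReal_mul (by positivity)] at h4
    simp only [hc, heatProfile]
    rw [← h2, ← mul_assoc _ (ENNReal.ofReal (((1 + r) * t) ^ a)), ← h4]
    ring

/-- By Minkowski in t, and since dilating by 1+r preserves the L^q(dt/t) norm, the kernel factors
out; β/2 < a makes its integral finite. -/
theorem eLpNorm_heatProfile_growthBessel_lt_top {p q : ℝ≥0∞} (hp : 1 ≤ p) (hq : 1 ≤ q) {a β : ℝ}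
    (hβ : 0 < β) (hab : β / 2 < a) {l : ℕ} {h : GrowthSpace}
    (hh : eLpNorm (heatProfile p a l h) q multMeasure < ∞) :
    eLpNorm (heatProfile p (a - β / 2) l (growthBessel β h)) q multMeasure < ∞ := by
  set Γc := ENNReal.ofReal (1 / Real.Gamma (β / 2)) with hΓc
  set N := eLpNorm (heatProfile p a l h) q multMeasure with hN
  have hm := measurable_heatProfile p a l h
  set w : ℝ → ℝ≥0∞ := fun r => ENNReal.ofReal (r ^ (β / 2) * (1 + r) ^ (-a)) with hw
  have hwm : Measurable w := by fun_prop
  have h1 := eLpNorm_lintegral_le (μ := multMeasure) (ν := multMeasure)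
    (F := fun t r => w r * heatProfile p a l h ((1 + r) * t)) (c := fun r => w r * N)
    ((hwm.comp measurable_snd).mul (hm.comp (by fun_prop))) (hwm.mul_const N) hq (by
      filter_upwards [ae_multMeasure_pos] with r hr
      refine (eLpNorm_le_mul_eLpNorm_of_ae_le_mul'' (c := w r)
        (g := fun t => heatProfile p a l h ((1 + r) * t)) q
        (hm.comp (measurable_const_mul _)).aestronglyMeasurable
        (.of_forall fun t => by simp)).trans_eq ?_
      rw [eLpNorm_comp_mul_left_multMeasure (by linarith) hm])
  rw [lintegral_mul_const _ hwm] at h1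
  have h2 : eLpNorm (heatProfile p (a - β / 2) l (growthBessel β h)) q multMeasure ≤
      Γc * eLpNorm (fun t => ∫⁻ r, w r * heatProfile p a l h ((1 + r) * t) ∂multMeasure) q
        multMeasure := by
    refine eLpNorm_le_mul_eLpNorm_of_ae_le_mul'' q ?_ ?_
    · exact (Measurable.lintegral_prod_right ((hwm.comp measurable_snd).mul
        (hm.comp (by fun_prop)))).aestronglyMeasurable
    · filter_upwards [ae_multMeasure_pos] with t ht
      exact heatProfile_growthBessel_le hp hβ a l h ht
  refine h2.trans_lt (ENNReal.mul_lt_top ENNReal.ofReal_lt_top (h1.trans_lt ?_))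
  exact ENNReal.mul_lt_top (lintegral_rpow_mul_one_add_rpow_lt_top (half_pos hβ) hab) hh

end BesovCondition

end DiscreteBesov

/-! ### Assembly of the theorem -/

theorem theorem1p2 (α β : ℝ) (hα : 0 < α) (hβ : 0 < β) (p q : ℝ≥0∞) (hp : 1 ≤ p) (hq : 1 ≤ q)
    (f : ℤ → ℝ) (hf : f ∈ DiscreteBesov.heatBesov α p q) :
    (∀ τ : ℝ, 0 < τ → ∀ n : ℤ,
      Summable fun j : ℤ => DiscreteBesov.heatKernel τ (n - j) * f j) ∧
    (∀ n : ℤ, IntegrableOn (DiscreteBesov.besselIntegrand β f n) (Ioi (0 : ℝ))) ∧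
    DiscreteBesov.besselPotential β f ∈ DiscreteBesov.heatBesov (α + β) p q := by
  open DiscreteBesov in
  obtain ⟨hf1, hf2⟩ := hf
  change MemLp (weighted α f) q weightMeasure at hf1
  obtain ⟨h, hh⟩ := exists_growthEval_eq_of_memLp hα.le hq hf1
  have hg := besselPotential_eq hβ hh
  refine ⟨fun τ _ n => ?_, fun n => integrableOn_besselIntegrand hβ hh n, ?_, ?_⟩
  · simpa only [hh] using (hasSum_heatKernel_mul τ h n).summable
  · rw [← funext hh] at hf1
    have h1 := memLp_weighted_of_le (γ := α + β) hα.le (by linarith)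
      (memLp_weighted_growthBessel hα.le hβ hq hf1)
    rwa [funext hg] at h1
  · rw [mixedNorm_eq hh] at hf2
    rw [mixedNorm_eq hg]
    set k := ⌊α / 2⌋₊ + 1 with hk
    set l := ⌊(α + β) / 2⌋₊ + 1 with hl
    -- The order is raised from k to l before applying the potential, since k - α/2 need not exceed
    -- β/2, whereas l - α/2 does because l > (α+β)/2.
    obtain ⟨m, hm⟩ : ∃ m, l = k + m := Nat.exists_eq_add_of_le
      (Nat.add_le_add_right (Nat.floor_le_floor (by linarith)) 1)
    have h1 := eLpNorm_heatProfile_add_lt_top hp hf2 m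
    have h2 : (α + β) / 2 < (l : ℝ) := by
      rw [hl]
      exact_mod_cast Nat.lt_floor_add_one ((α + β) / 2)
    have e1 : ((k : ℝ) - α / 2 + m) = (l : ℝ) - α / 2 := by
      rw [hm]
      push_cast
      ring
    rw [e1, ← hm] at h1
    have h3 := eLpNorm_heatProfile_growthBessel_lt_top hp hq hβ (by linarith) h1
    rwa [show (l : ℝ) - α / 2 - β / 2 = l - (α + β) / 2 by ring] at h3
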